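/- Let $T$ be a strongly continuous, non-trivial, irreducible unitary representation of $SL(2,\mathbb R)$ on a complex separable Hilbert space $\mathcal H$. Put $$r(\theta)=\begin{pmatrix}\cos\theta&\sin\theta\\-\sin\theta&\cos\theta\end{pmatrix},\quad a(t)=\begin{pmatrix}e^t&0\\0&e^{-t}\end{pmatrix},\quad W=\begin{pmatrix}0&1\\-1&0\end{pmatrix},\quad Q=\begin{pmatrix}1&0\\0&-1\end{pmatrix},\quad V=\begin{pmatrix}0&1\\1&0\end{pmatrix}.$$ For $X\in\{W,Q,V\}$ let $L_Xv=\lim_{t\to0}\frac{T(\exp(tX))v-v}{t}$, and let $\Omega_T=(L_V^2+L_Q^2-L_W^2)/4$ be the Casimir operator on the $C^2$-vectors of $T$ (the $v\in\mathcal H$ for which $g\mapsto T(g)v$ is $C^2$). Let $\mathcal H_n=\{v\in\mathcal H: T(r(\theta))v=e^{in\theta}v\ \ \forall\theta\in\mathbb R\}$ for $n\in\mathbb Z$, and let $(\phi_n)_{n\in\mathbb Z}$ be a family with $\phi_n\in\mathcal H_n$, with $\phi_n\neq0$ if and only if $\dim\mathcal H_n=1$, and whose non-zero members form an orthonormal basis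 of $\mathcal H$. Let $B_{n,m}(t)=\langle\phi_n,T(a(t))\phi_m\rangle$. Then there is a unique $\lambda=\lambda(T)\in\mathbb R$ such that $\Omega_Tv=\lambda v$ for every $C^2$-vector $v$, and for all $n,m\in\mathbb Z$ and all $t\ge1$ $$|B_{n,m}(t)|\le\bigl(\bar K_\lambda(m^2+n^2)+\tilde K_\lambda\bigr)\,b_\lambda(t),$$ where $$C_1=\frac1{1-e^{-4}},\qquad C_2=\frac{2}{1-e^{-4}}\left(1+\frac{2}{e^2(1-e^{-4})}+\frac{2}{e^4(1-e^{-4})}\right),$$ $$\bar K_\lambda=\begin{cases}\dfrac{4C_1}{9e^3}+\dfrac{2C_2}{e}+e&\text{if }\lambda<0,\\[2mm]\dfrac{C_1+C_2}2&\text{if }\lambda\ge0,\end{cases}\qquad \tilde K_\lambda=\begin{cases}(1+2\sqrt2)e+\dfrac{(32+\sqrt2)C_1^2}{3e^3}&\text{if }\lambda\le-\frac14,\\[2mm]3e+e^2+\dfrac{4C_1}{9e^3}&\text{if }-\frac14<\lambda<0,\\[2mm]e^2&\text{if }\lambda\ge0,\end{cases}$$ $$b_\lambda(t)=\begin{cases}te^{-t}&\text{if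 }\lambda\le-\frac14,\\ te^{(-1+\sqrt{1+4\lambda})t}&\text{if }-\frac14<\lambda<0,\\ te^{-2t}&\text{if }\lambda\ge0.\end{cases}$$ -/

import Mathlib

open scoped MatrixGroups

noncomputable section

namespace Ratner

/-! ### One-parameter subgroups of `SL(2, ℝ)` -/

/-- `r(θ)`, the rotation subgroup. -/
def rot (θ : ℝ) : SL(2, ℝ) :=
  ⟨!![Real.cos θ, Real.sin θ; -Real.sin θ, Real.cos θ], by
    rw [Matrix.det_fin_two_of]; nlinarith [Real.sin_sq_add_cos_sq θ]⟩

/-- `a(t)`, the positive diagonal subgroup. -/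
def diag (t : ℝ) : SL(2, ℝ) :=
  ⟨!![Real.exp t, 0; 0, Real.exp (-t)], by
    rw [Matrix.det_fin_two_of, ← Real.exp_add]; simp⟩

/-- The hyperbolic subgroup generated by the symmetric matrix `V`. -/
def hyp (t : ℝ) : SL(2, ℝ) :=
  ⟨!![Real.cosh t, Real.sinh t; Real.sinh t, Real.cosh t], by
    rw [Matrix.det_fin_two_of]; nlinarith [Real.cosh_sq_sub_sinh_sq t]⟩

/-- The basis `W`, `Q`, `V` of the Lie algebra of trace zero matrices. -/
def matW : Matrix (Fin 2) (Fin 2) ℝ := !![0, 1; -1, 0]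

def matQ : Matrix (Fin 2) (Fin 2) ℝ := !![1, 0; 0, -1]

def matV : Matrix (Fin 2) (Fin 2) ℝ := !![0, 1; 1, 0]

theorem eq_exp_of_hasDerivAt_aux {A : Type*} [NormedRing A] [NormedAlgebra ℝ A] [CompleteSpace A]
    (X : A) (M : ℝ → A) (h0 : M 0 = 1) (hM : ∀ t, HasDerivAt M (X * M t) t) (t : ℝ) :
    M t = NormedSpace.exp (t • X) := by
  let _ : NormedAlgebra ℚ A := NormedAlgebra.restrictScalars ℚ ℝ A
  have hE : ∀ t : ℝ, HasDerivAt (fun s : ℝ => NormedSpace.exp (s • (-X)))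
      (NormedSpace.exp (t • (-X)) * (-X)) t := fun t => hasDerivAt_exp_smul_const (-X) t
  have hP : ∀ t : ℝ, HasDerivAt (fun s : ℝ => NormedSpace.exp (s • (-X)) * M s) 0 t := by
    intro t
    refine ((hE t).fun_mul (hM t)).congr_deriv ?_
    rw [mul_neg, neg_mul, mul_assoc, neg_add_cancel]
  have hc := is_const_of_deriv_eq_zero (fun s => (hP s).differentiableAt)
    (fun s => (hP s).deriv) t 0
  simp only [zero_smul, NormedSpace.exp_zero, h0, mul_one] at hc
  have hinv : NormedSpace.exp (t • X) * NormedSpace.exp (t • (-X)) = 1 := by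
    rw [smul_neg, ← NormedSpace.exp_add_of_commute (Commute.neg_right (Commute.refl _)),
      add_neg_cancel, NormedSpace.exp_zero]
  calc M t = NormedSpace.exp (t • X) * (NormedSpace.exp (t • (-X)) * M t) := by
        rw [← mul_assoc, hinv, one_mul]
    _ = _ := by rw [hc, mul_one]

/-- A matrix curve with `M' = X M` and `M 0 = 1` is `t ↦ exp (t X)`. -/
theorem eq_exp_of_hasDerivAt (X : Matrix (Fin 2) (Fin 2) ℝ)
    (M : ℝ → Matrix (Fin 2) (Fin 2) ℝ) (h0 : M 0 = 1)
    (hM : ∀ t i j, HasDerivAt (fun s => M s i j) ((X * M t) i j) t) (t : ℝ) :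
    M t = NormedSpace.exp (t • X) := by
  let _ : NormedRing (Matrix (Fin 2) (Fin 2) ℝ) := Matrix.linftyOpNormedRing
  let _ : NormedAlgebra ℝ (Matrix (Fin 2) (Fin 2) ℝ) := Matrix.linftyOpNormedAlgebra
  exact eq_exp_of_hasDerivAt_aux X M h0
    (fun t => hasDerivAt_pi.2 fun i => hasDerivAt_pi.2 fun j => hM t i j) t

theorem rot_eq_exp (t : ℝ) : (rot t).1 = NormedSpace.exp (t • matW) := by
  refine eq_exp_of_hasDerivAt matW (fun t => (rot t).1) ?_ ?_ t
  · ext i j; fin_cases i <;> fin_cases j <;> simp [rot]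
  · intro t i j
    fin_cases i <;> fin_cases j <;>
      simp [rot, matW, Matrix.mul_apply, Fin.sum_univ_two, Real.hasDerivAt_sin,
        Real.hasDerivAt_cos, (Real.hasDerivAt_sin t).fun_neg]

theorem diag_eq_exp (t : ℝ) : (diag t).1 = NormedSpace.exp (t • matQ) := by
  refine eq_exp_of_hasDerivAt matQ (fun t => (diag t).1) ?_ ?_ t
  · ext i j; fin_cases i <;> fin_cases j <;> simp [diag]
  · intro t i j
    have h := (Real.hasDerivAt_exp (-t)).scomp t (hasDerivAt_neg t)
    fin_cases i <;> fin_cases j <;>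
      simp [diag, matQ, Matrix.mul_apply, Fin.sum_univ_two, Real.hasDerivAt_exp,
        hasDerivAt_const]
    simpa [Function.comp_def] using h

theorem hyp_eq_exp (t : ℝ) : (hyp t).1 = NormedSpace.exp (t • matV) := by
  refine eq_exp_of_hasDerivAt matV (fun t => (hyp t).1) ?_ ?_ t
  · ext i j; fin_cases i <;> fin_cases j <;> simp [hyp]
  · intro t i j
    fin_cases i <;> fin_cases j <;>
      simp [hyp, matV, Matrix.mul_apply, Fin.sum_univ_two, Real.hasDerivAt_sinh,
        Real.hasDerivAt_cosh]

/-! ### Unitary representations -/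

variable {H : Type*} [NormedAddCommGroup H] [InnerProductSpace ℂ H]

/-- Strong continuity of a representation by unitary operators. -/
def IsStronglyContinuous (T : SL(2, ℝ) →* (H ≃ₗᵢ[ℂ] H)) : Prop :=
  ∀ v : H, Continuous fun g : SL(2, ℝ) => T g v

/-- Topological irreducibility: the space is nonzero and its only closed invariant subspaces are
zero and the whole space. -/
def IsIrreducible (T : SL(2, ℝ) →* (H ≃ₗᵢ[ℂ] H)) : Prop :=
  Nontrivial H ∧ ∀ S : Submodule ℂ H, IsClosed (S : Set H) →
    (∀ g : SL(2, ℝ), ∀ v ∈ S, T g v ∈ S) → S = ⊥ ∨ S = ⊤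

/-- `v` is a `C^k`-vector: the orbit map `g ↦ T g v` is `C^k` on the embedded submanifold `SL(2, ℝ)`
of the space of real `2 × 2` matrices, i.e. it is the restriction of a map that is `C^k` near
every point of `SL(2, ℝ)`. -/
def IsCkVector (T : SL(2, ℝ) →* (H ≃ₗᵢ[ℂ] H)) (k : ℕ) (v : H) : Prop :=
  ∃ F : (Fin 2 → Fin 2 → ℝ) → H,
    ∀ g : SL(2, ℝ), ContDiffAt ℝ k F (fun i j => g i j) ∧ F (fun i j => g i j) = T g v

/-- The Lie derivative of `v` along a one-parameter subgroup `γ`,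
the limit of `(T (γ t) v - v) / t` as `t → 0`. -/
def lieDeriv (T : SL(2, ℝ) →* (H ≃ₗᵢ[ℂ] H)) (γ : ℝ → SL(2, ℝ)) (v : H) : H :=
  deriv (fun t : ℝ => T (γ t) v) 0

/-- The Casimir operator `(L_V² + L_Q² - L_W²) / 4`, to be applied to `C²`-vectors. -/
def casimir (T : SL(2, ℝ) →* (H ≃ₗᵢ[ℂ] H)) (v : H) : H :=
  (1 / 4 : ℂ) • (lieDeriv T hyp (lieDeriv T hyp v) + lieDeriv T diag (lieDeriv T diag v)
    - lieDeriv T rot (lieDeriv T rot v))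

/-- `lam` is the Casimir parameter `λ(T)`: one has `Ω v = lam v` for every `C²`-vector `v`. -/
def IsCasimirParameter (T : SL(2, ℝ) →* (H ≃ₗᵢ[ℂ] H)) (lam : ℝ) : Prop :=
  ∀ v : H, IsCkVector T 2 v → casimir T v = (lam : ℂ) • v

/-- The `K`-type space `H_n = {v | T (r θ) v = exp (i n θ) v for all θ}`. -/
def kTypeSpace (T : SL(2, ℝ) →* (H ≃ₗᵢ[ℂ] H)) (n : ℤ) : Submodule ℂ H where
  carrier := {v | ∀ θ : ℝ, T (rot θ) v = Complex.exp (Complex.I * n * θ) • v}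
  add_mem' := by
    intro v w hv hw θ
    rw [map_add, hv θ, hw θ, smul_add]
  zero_mem' := by
    intro θ
    simp
  smul_mem' := by
    intro c v hv θ
    rw [map_smul, hv θ, smul_comm]

/-- A family `(φ_n)` with `φ_n ∈ H_n`, `φ_n ≠ 0` exactly when `dim H_n = 1`, whose nonzero members
form an orthonormal basis of the Hilbert space. -/
structure IsKTypeBasis (T : SL(2, ℝ) →* (H ≃ₗᵢ[ℂ] H)) (φ : ℤ → H) : Prop where
  mem : ∀ n, φ n ∈ kTypeSpace T n
  ne_zero_iff : ∀ n, φ n ≠ 0 ↔ Module.finrank ℂ (kTypeSpace T n) = 1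
  orthonormal : Orthonormal ℂ (fun n : {n : ℤ // φ n ≠ 0} => φ n)
  total : (Submodule.span ℂ (Set.range φ)).topologicalClosure = ⊤

/-- The matrix coefficient `B_{n,m}(t) = ⟨φ_n, T(a(t)) φ_m⟩`. -/
def coeff (T : SL(2, ℝ) →* (H ≃ₗᵢ[ℂ] H)) (φ : ℤ → H) (n m : ℤ) (t : ℝ) : ℂ :=
  inner ℂ (φ n) (T (diag t) (φ m))

/-! ### Explicit constants -/

def C1 : ℝ := (1 - Real.exp (-4))⁻¹

def C2 : ℝ := 2 / (1 - Real.exp (-4)) *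
  (1 + 2 / (Real.exp 2 * (1 - Real.exp (-4))) + 2 / (Real.exp 4 * (1 - Real.exp (-4))))

/-- The constant multiplying `m² + n²`; it is the same for `lam ≤ -1/4` and `-1/4 < lam < 0`. -/
def Kbar (lam : ℝ) : ℝ :=
  if lam < 0 then 4 * C1 / (9 * Real.exp 3) + 2 * C2 / Real.exp 1 + Real.exp 1
  else (C1 + C2) / 2

def Ktilde (lam : ℝ) : ℝ :=
  if lam ≤ -1 / 4 then
    (1 + 2 * √2) * Real.exp 1 + (32 + √2) * C1 ^ 2 / (3 * Real.exp 3)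
  else if lam < 0 then
    3 * Real.exp 1 + Real.exp 2 + 4 * C1 / (9 * Real.exp 3)
  else Real.exp 2

def b (lam t : ℝ) : ℝ :=
  if lam ≤ -1 / 4 then t * Real.exp (-t)
  else if lam < 0 then t * Real.exp ((-1 + √(1 + 4 * lam)) * t)
  else t * Real.exp (-2 * t)

end Ratner

end

/-!
Averaging against smooth functions and projecting shows that a one-dimensional `K`-type consists of
smooth vectors, so the invariant symmetric operator `Ω_T` acts on `φ n` by a real scalar, and by
irreducibility on every `C²`-vector by the same scalar `λ`. In polar coordinates a matrix
coefficient `y` along the diagonal subgroup then solves a radial second order equation, and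
`z = √(2 sinh 2t) y` satisfies `z'' = (1 + 4λ + q(t)) z` with `q = O(e^{-2t})`. For `λ < 0`,
Duhamel's formula and `|y| ≤ 1` bound `z` by the growth of the unperturbed solutions. For `λ ≥ 0`
this growth is too fast, and the growing mode is excluded because the matrix coefficients vanish at
infinity.
-/

namespace Ratner

open Filter Topology

attribute [local instance] Matrix.linftyOpNormedRing Matrix.linftyOpNormedAlgebra

/-! ### Orbit maps and Lie derivatives -/

/-- The algebra of real `2 × 2` matrices, which serves as the ambient space of `SL(2, ℝ)`. -/
abbrev Mat2 : Type := Matrix (Fin 2) (Fin 2) ℝ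

/-- `γ` is a one-parameter subgroup of `SL(2, ℝ)` with tangent vector `X` at the identity. -/
structure IsOneParam (γ : ℝ → SL(2, ℝ)) (X : Mat2) : Prop where
  zero : γ 0 = 1
  add : ∀ s t, γ (s + t) = γ s * γ t
  deriv : HasDerivAt (fun s => (γ s : Mat2)) X 0

namespace IsOneParam

variable {γ : ℝ → SL(2, ℝ)} {X : Mat2}

theorem of_exp (h : ∀ t, (γ t : Mat2) = NormedSpace.exp (t • X)) : IsOneParam γ X where
  zero := Subtype.ext (by simp [h])
  add s t := by
    refine Subtype.ext ?_
    rw [Matrix.SpecialLinearGroup.coe_mul, h, h, h, add_smul]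
    exact Matrix.exp_add_of_commute _ _ (((Commute.refl X).smul_left s).smul_right t)
  deriv := by
    simp only [h]
    exact (hasDerivAt_exp_smul_const (𝕂 := ℝ) X 0).congr_deriv (by simp)

theorem neg (h : IsOneParam γ X) (t : ℝ) : γ (-t) = (γ t)⁻¹ := by
  rw [eq_inv_iff_mul_eq_one, ← h.add, neg_add_cancel, h.zero]

theorem hasDerivAt_mul_left (h : IsOneParam γ X) (g : SL(2, ℝ)) :
    HasDerivAt (fun s => ((g * γ s : SL(2, ℝ)) : Mat2)) (g * X) 0 := by
  simp only [Matrix.SpecialLinearGroup.coe_mul]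
  exact h.deriv.const_mul (g : Mat2)

theorem conj (h : IsOneParam γ X) (g : SL(2, ℝ)) :
    IsOneParam (fun t => g⁻¹ * γ t * g) ((g⁻¹ : SL(2, ℝ)) * X * g) where
  zero := by simp [h.zero]
  add s t := by simp only [h.add]; group
  deriv := by
    simp only [Matrix.SpecialLinearGroup.coe_mul]
    exact (h.deriv.const_mul ((g⁻¹ : SL(2, ℝ)) : Mat2)).mul_const (g : Mat2)

end IsOneParam

theorem isOneParam_rot : IsOneParam rot matW := .of_exp rot_eq_exp

theorem isOneParam_diag : IsOneParam diag matQ := .of_exp diag_eq_exp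

theorem isOneParam_hyp : IsOneParam hyp matV := .of_exp hyp_eq_exp

variable {H : Type*} [NormedAddCommGroup H] [InnerProductSpace ℂ H]
  {T : SL(2, ℝ) →* (H ≃ₗᵢ[ℂ] H)}

/-- `F` is a `C^k` extension of the orbit map of `v` to a neighbourhood of `SL(2, ℝ)` in the
algebra of matrices. -/
def IsOrbitExt (T : SL(2, ℝ) →* (H ≃ₗᵢ[ℂ] H)) (k : ℕ) (v : H) (F : Mat2 → H) : Prop :=
  ∀ g : SL(2, ℝ), ContDiffAt ℝ k F g ∧ F g = T g v

/-- The entries of a matrix, as a map to the space on which `IsCkVector` is defined; the two spaces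
carry different but equivalent norms. -/
noncomputable def entries : Mat2 ≃L[ℝ] (Fin 2 → Fin 2 → ℝ) :=
  (Matrix.ofLinearEquiv ℝ).symm.toContinuousLinearEquiv

theorem isCkVector_iff {k : ℕ} {v : H} : IsCkVector T k v ↔ ∃ F, IsOrbitExt T k v F := by
  constructor
  · rintro ⟨F, hF⟩
    exact ⟨F ∘ entries, fun g => ⟨(hF g).1.comp (g : Mat2) entries.contDiff.contDiffAt, (hF g).2⟩⟩
  · rintro ⟨F, hF⟩
    exact ⟨F ∘ entries.symm, fun g => ⟨(hF g).1.comp (fun i j => g i j)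
      entries.symm.contDiff.contDiffAt, (hF g).2⟩⟩

namespace IsOrbitExt

variable {k : ℕ} {v : H} {F : Mat2 → H} {γ η : ℝ → SL(2, ℝ)} {X Y : Mat2}

theorem mono {l : ℕ} (hF : IsOrbitExt T k v F) (h : l ≤ k) : IsOrbitExt T l v F :=
  fun g => ⟨(hF g).1.of_le (by exact_mod_cast h), (hF g).2⟩

theorem hasDerivAt (hF : IsOrbitExt T 1 v F) {c : ℝ → SL(2, ℝ)} {Z : Mat2} {s : ℝ}
    (hc : HasDerivAt (fun s => (c s : Mat2)) Z s) :
    HasDerivAt (fun s => T (c s) v) (fderiv ℝ F (c s) Z) s := by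
  have h := ((hF (c s)).1.differentiableAt (by simp)).hasFDerivAt.comp_hasDerivAt s hc
  exact h.congr_of_eventuallyEq (.of_forall fun t => (hF (c t)).2.symm)

theorem hasDerivAt_lieDeriv (hF : IsOrbitExt T 1 v F) (hγ : IsOneParam γ X) :
    HasDerivAt (fun s => T (γ s) v) (lieDeriv T γ v) 0 :=
  (hF.hasDerivAt hγ.deriv).differentiableAt.hasDerivAt

theorem apply_lieDeriv (hF : IsOrbitExt T 1 v F) (hγ : IsOneParam γ X) (g : SL(2, ℝ)) :
    T g (lieDeriv T γ v) = fderiv ℝ F g (g * X) := by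
  have h₁ := hF.hasDerivAt (hγ.hasDerivAt_mul_left g)
  have h₂ := ((T g).toContinuousLinearEquiv.toContinuousLinearMap.restrictScalars
    ℝ).hasFDerivAt.comp_hasDerivAt (0 : ℝ) (hF.hasDerivAt_lieDeriv hγ)
  rw [hγ.zero, mul_one] at h₁
  refine h₂.unique (h₁.congr_of_eventuallyEq (.of_forall fun t => ?_))
  simp [map_mul]

theorem lie (hF : IsOrbitExt T (k + 1) v F) (hγ : IsOneParam γ X) :
    IsOrbitExt T k (lieDeriv T γ v) (fun A => fderiv ℝ F A (A * X)) := fun g =>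
  ⟨((hF g).1.fderiv_right (m := k) (by simp)).clm_apply (contDiffAt_id.mul contDiffAt_const),
    ((hF.mono (by lia)).apply_lieDeriv hγ g).symm⟩

theorem translate (hF : IsOrbitExt T k v F) (g : SL(2, ℝ)) :
    IsOrbitExt T k (T g v) (fun A => F (A * g)) := fun h => by
  have h₁ := hF (h * g)
  rw [Matrix.SpecialLinearGroup.coe_mul, map_mul] at h₁
  exact ⟨h₁.1.comp (h : Mat2) (contDiffAt_id.mul contDiffAt_const), h₁.2⟩

end IsOrbitExt

namespace IsCkVector

variable {k : ℕ} {v : H} {γ : ℝ → SL(2, ℝ)} {X : Mat2}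

theorem mono {l : ℕ} (hv : IsCkVector T k v) (h : l ≤ k) : IsCkVector T l v := by
  obtain ⟨F, hF⟩ := isCkVector_iff.1 hv
  exact isCkVector_iff.2 ⟨_, hF.mono h⟩

theorem apply (hv : IsCkVector T k v) (g : SL(2, ℝ)) : IsCkVector T k (T g v) := by
  obtain ⟨F, hF⟩ := isCkVector_iff.1 hv
  exact isCkVector_iff.2 ⟨_, hF.translate g⟩

theorem smul (hv : IsCkVector T k v) (c : ℂ) : IsCkVector T k (c • v) := by
  obtain ⟨F, hF⟩ := hv
  exact ⟨fun A => c • F A, fun g => ⟨(hF g).1.const_smul c, by simp only [(hF g).2, map_smul]⟩⟩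

theorem lieDeriv (hv : IsCkVector T (k + 1) v) (hγ : IsOneParam γ X) :
    IsCkVector T k (lieDeriv T γ v) := by
  obtain ⟨F, hF⟩ := isCkVector_iff.1 hv
  exact isCkVector_iff.2 ⟨_, hF.lie hγ⟩

theorem hasDerivAt_zero (hv : IsCkVector T 1 v) (hγ : IsOneParam γ X) :
    HasDerivAt (fun s => T (γ s) v) (Ratner.lieDeriv T γ v) 0 := by
  obtain ⟨F, hF⟩ := isCkVector_iff.1 hv
  exact hF.hasDerivAt_lieDeriv hγ

theorem hasDerivAt (hv : IsCkVector T 1 v) (hγ : IsOneParam γ X) (t : ℝ) :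
    HasDerivAt (fun s => T (γ s) v) (T (γ t) (Ratner.lieDeriv T γ v)) t := by
  have h₁ := HasDerivAt.scomp t (h := fun s => s - t)
    (by simpa using hv.hasDerivAt_zero hγ) ((hasDerivAt_id t).sub_const t)
  have h₂ := ((T (γ t)).toContinuousLinearEquiv.toContinuousLinearMap.restrictScalars
    ℝ).hasFDerivAt.comp_hasDerivAt t h₁
  refine (h₂.congr_of_eventuallyEq (.of_forall fun s => ?_)).congr_deriv (by simp)
  have h₃ : γ s = γ t * γ (s - t) := by rw [← hγ.add, add_sub_cancel]
  simp [h₃, map_mul]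

theorem lieDeriv_apply (hv : IsCkVector T 1 v) (hγ : IsOneParam γ X) (g : SL(2, ℝ)) :
    Ratner.lieDeriv T γ (T g v) = T g (Ratner.lieDeriv T (fun t => g⁻¹ * γ t * g) v) := by
  have h := ((T g).toContinuousLinearEquiv.toContinuousLinearMap.restrictScalars
    ℝ).hasFDerivAt.comp_hasDerivAt (0 : ℝ) (hv.hasDerivAt_zero (hγ.conj g))
  refine ((hv.apply g).hasDerivAt_zero hγ).unique
    (h.congr_of_eventuallyEq (.of_forall fun t => ?_))
  simp [map_mul]

end IsCkVector

/-- `D` and `B` compute the first and second order Lie derivatives of `v`: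
`L_X v = D X` and `L_X L_Y v = B X Y`. -/
structure IsTwoJet (T : SL(2, ℝ) →* (H ≃ₗᵢ[ℂ] H)) (v : H) (D : Mat2 →ₗ[ℝ] H)
    (B : Mat2 →ₗ[ℝ] Mat2 →ₗ[ℝ] H) : Prop where
  lieDeriv_eq {γ : ℝ → SL(2, ℝ)} {X : Mat2} : IsOneParam γ X → lieDeriv T γ v = D X
  lieDeriv_lieDeriv_eq {γ η : ℝ → SL(2, ℝ)} {X Y : Mat2} : IsOneParam γ X → IsOneParam η Y →
    lieDeriv T γ (lieDeriv T η v) = B X Y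
  sub_swap (X Y : Mat2) : B X Y - B Y X = D (X * Y - Y * X)

theorem IsCkVector.exists_isTwoJet {v : H} (hv : IsCkVector T 2 v) : ∃ D B, IsTwoJet T v D B := by
  obtain ⟨F, hF⟩ := isCkVector_iff.1 hv
  have hF₁ : ContDiffAt ℝ 2 F 1 := by simpa using (hF 1).1
  have hF₂ : DifferentiableAt ℝ (fderiv ℝ F) 1 :=
    (hF₁.fderiv_right (m := 1) (by norm_num)).differentiableAt (by simp)
  let B : Mat2 →ₗ[ℝ] Mat2 →ₗ[ℝ] H := LinearMap.mk₂ ℝ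
    (fun X Y => fderiv ℝ (fderiv ℝ F) 1 X Y + fderiv ℝ F 1 (X * Y))
    (fun X X' Y => by simp [add_mul]; abel) (fun c X Y => by simp)
    (fun X Y Y' => by simp [mul_add]; abel) (fun c X Y => by simp)
  refine ⟨(fderiv ℝ F 1).toLinearMap, B, fun {γ X} hγ => ?_, fun {γ η X Y} hγ hη => ?_,
    fun X Y => ?_⟩
  · simpa using (hF.mono one_le_two).apply_lieDeriv hγ 1
  · have h := (IsOrbitExt.lie (k := 1) hF hη).apply_lieDeriv hγ 1
    simp only [map_one, LinearIsometryEquiv.coe_one, id_eq, Matrix.SpecialLinearGroup.coe_one,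
      one_mul] at h
    refine h.trans ((DFunLike.congr_fun (hF₂.hasFDerivAt.clm_apply
      ((hasFDerivAt_id (1 : Mat2)).mul_const' Y)).fderiv X).trans ?_)
    rw [id_eq, one_mul, add_comm]
    rfl
  · have h : fderiv ℝ (fderiv ℝ F) 1 X Y = fderiv ℝ (fderiv ℝ F) 1 Y X :=
      (hF₁.isSymmSndFDerivAt (by simp)).eq X Y
    simp [B, h]

theorem inner_apply_left (g : SL(2, ℝ)) (v w : H) :
    inner ℂ (T g v) w = inner ℂ v (T g⁻¹ w) := by
  rw [← (T g).inner_map_map v, map_inv]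
  exact congrArg _ ((T g).apply_symm_apply w).symm

theorem inner_apply_right (g : SL(2, ℝ)) (v w : H) :
    inner ℂ v (T g w) = inner ℂ (T g⁻¹ v) w := by
  rw [inner_apply_left, inv_inv]

theorem inner_lieDeriv {v w : H} (hv : IsCkVector T 1 v) (hw : IsCkVector T 1 w)
    {γ : ℝ → SL(2, ℝ)} {X : Mat2} (hγ : IsOneParam γ X) :
    inner ℂ (lieDeriv T γ v) w = -inner ℂ v (lieDeriv T γ w) := by
  have h₁ := (hv.hasDerivAt_zero hγ).inner ℂ (hasDerivAt_const (0 : ℝ) w)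
  have h₂ := (hasDerivAt_const (0 : ℝ) v).inner ℂ (HasDerivAt.scomp (0 : ℝ)
    (by simpa using hw.hasDerivAt_zero hγ) (hasDerivAt_neg (0 : ℝ)))
  simp only [inner_zero_right, inner_zero_left, zero_add, add_zero, neg_smul, one_smul,
    inner_neg_right] at h₁ h₂
  refine h₁.unique (h₂.congr_of_eventuallyEq (.of_forall fun t => ?_))
  simp [inner_apply_left, hγ.neg]

theorem inner_lieDeriv_lieDeriv {v w : H} (hv : IsCkVector T 2 v) (hw : IsCkVector T 2 w)
    {γ : ℝ → SL(2, ℝ)} {X : Mat2} (hγ : IsOneParam γ X) :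
    inner ℂ (lieDeriv T γ (lieDeriv T γ v)) w = inner ℂ v (lieDeriv T γ (lieDeriv T γ w)) := by
  rw [inner_lieDeriv (hv.lieDeriv hγ) (hw.mono one_le_two) hγ,
    inner_lieDeriv (hv.mono one_le_two) (hw.lieDeriv hγ) hγ, neg_neg]

theorem inner_casimir {v w : H} (hv : IsCkVector T 2 v) (hw : IsCkVector T 2 w) :
    inner ℂ (casimir T v) w = inner ℂ v (casimir T w) := by
  simp only [casimir, inner_smul_left, inner_smul_right, inner_add_left, inner_add_right,
    inner_sub_left, inner_sub_right, inner_lieDeriv_lieDeriv hv hw isOneParam_rot,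
    inner_lieDeriv_lieDeriv hv hw isOneParam_diag, inner_lieDeriv_lieDeriv hv hw isOneParam_hyp,
    map_div₀, map_one, Complex.conj_ofNat]

section MatrixUnits

variable {ι R M : Type*} [Fintype ι] [DecidableEq ι] [CommRing R] [AddCommGroup M] [Module R M]

theorem mul_single_eq_sum (A : Matrix ι ι R) (i j : ι) :
    A * Matrix.single i j 1 = ∑ k, A k i • Matrix.single k j (1 : R) := by
  ext k l
  simp [Matrix.sum_apply, Matrix.mul_apply, Matrix.single_apply, ite_and]

theorem single_mul_eq_sum (A : Matrix ι ι R) (i j : ι) :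
    Matrix.single i j 1 * A = ∑ l, A j l • Matrix.single i l (1 : R) := by
  ext k l
  simp [Matrix.sum_apply, Matrix.mul_apply, Matrix.single_apply, ite_and]

theorem sum_mul_single_eq_sum_single_mul
    (B : Matrix ι ι R →ₗ[R] Matrix ι ι R →ₗ[R] M) (A : Matrix ι ι R) :
    ∑ i, ∑ j, B (A * Matrix.single i j 1) (A * Matrix.single j i 1) =
      ∑ i, ∑ j, B (Matrix.single i j 1 * A) (Matrix.single j i 1 * A) := by
  simp only [mul_single_eq_sum, single_mul_eq_sum, map_sum, map_smul, LinearMap.sum_apply,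
    LinearMap.smul_apply, Finset.smul_sum]
  simp only [← Fintype.sum_prod_type']
  exact Fintype.sum_equiv ⟨fun p => (p.2.2.2, p.2.2.1, p.1, p.2.1),
    fun p => (p.2.2.1, p.2.2.2, p.2.1, p.1), fun _ => rfl, fun _ => rfl⟩ _ _
    fun _ => smul_comm _ _ _

theorem sum_conj_single (B : Matrix ι ι R →ₗ[R] Matrix ι ι R →ₗ[R] M)
    {A A' : Matrix ι ι R} (hA : A * A' = 1) :
    ∑ i, ∑ j, B (A * Matrix.single i j 1 * A') (A * Matrix.single j i 1 * A') =
      ∑ i, ∑ j, B (Matrix.single i j 1) (Matrix.single j i 1) := by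
  have h := sum_mul_single_eq_sum_single_mul (B.compl₁₂ (LinearMap.mulRight R A')
    (LinearMap.mulRight R A')) A
  simpa [mul_assoc, hA] using h

end MatrixUnits

/-- The right-hand side does not depend on a choice of basis, which makes its invariance under
conjugation visible. -/
theorem casimirForm_eq {M : Type*} [AddCommGroup M] [Module ℝ M]
    (B : Mat2 →ₗ[ℝ] Mat2 →ₗ[ℝ] M) :
    B matV matV + B matQ matQ - B matW matW =
      2 • ∑ i, ∑ j, B (Matrix.single i j 1) (Matrix.single j i 1) - B 1 1 := by
  have hV : matV = Matrix.single 0 1 1 + Matrix.single 1 0 1 := by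
    ext i j; fin_cases i <;> fin_cases j <;> simp [matV]
  have hW : matW = Matrix.single 0 1 1 - Matrix.single 1 0 1 := by
    ext i j; fin_cases i <;> fin_cases j <;> simp [matW]
  have hQ : matQ = Matrix.single 0 0 1 - Matrix.single 1 1 1 := by
    ext i j; fin_cases i <;> fin_cases j <;> simp [matQ]
  have h1 : (1 : Mat2) = Matrix.single 0 0 1 + Matrix.single 1 1 1 := by
    ext i j; fin_cases i <;> fin_cases j <;> simp
  simp only [hV, hW, hQ, h1, Fin.sum_univ_two, map_add, map_sub, LinearMap.add_apply,
    LinearMap.sub_apply]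
  abel

theorem casimirForm_conj {M : Type*} [AddCommGroup M] [Module ℝ M]
    (B : Mat2 →ₗ[ℝ] Mat2 →ₗ[ℝ] M) (g : SL(2, ℝ)) :
    B ((g⁻¹ : SL(2, ℝ)) * matV * g) ((g⁻¹ : SL(2, ℝ)) * matV * g) +
        B ((g⁻¹ : SL(2, ℝ)) * matQ * g) ((g⁻¹ : SL(2, ℝ)) * matQ * g) -
        B ((g⁻¹ : SL(2, ℝ)) * matW * g) ((g⁻¹ : SL(2, ℝ)) * matW * g) =
      B matV matV + B matQ matQ - B matW matW := by
  have hg : ((g⁻¹ : SL(2, ℝ)) : Mat2) * g = 1 := by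
    rw [← Matrix.SpecialLinearGroup.coe_mul, inv_mul_cancel, Matrix.SpecialLinearGroup.coe_one]
  let C : Mat2 →ₗ[ℝ] Mat2 := LinearMap.mulLeftRight ℝ (((g⁻¹ : SL(2, ℝ)) : Mat2), (g : Mat2))
  have h := casimirForm_eq (B.compl₁₂ C C)
  simp only [LinearMap.compl₁₂_apply, C, LinearMap.mulLeftRight_apply, sum_conj_single B hg,
    mul_one, hg] at h
  rw [h, casimirForm_eq]

namespace IsTwoJet

variable {v w : H} {D : Mat2 →ₗ[ℝ] H} {B : Mat2 →ₗ[ℝ] Mat2 →ₗ[ℝ] H}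

theorem casimir_eq (hJ : IsTwoJet T v D B) :
    casimir T v = (1 / 4 : ℂ) • (B matV matV + B matQ matQ - B matW matW) := by
  simp only [casimir, hJ.lieDeriv_lieDeriv_eq isOneParam_hyp isOneParam_hyp,
    hJ.lieDeriv_lieDeriv_eq isOneParam_diag isOneParam_diag,
    hJ.lieDeriv_lieDeriv_eq isOneParam_rot isOneParam_rot]

theorem lieDeriv_lieDeriv_apply (hJ : IsTwoJet T v D B) (hv : IsCkVector T 2 v)
    {γ : ℝ → SL(2, ℝ)} {X : Mat2} (hγ : IsOneParam γ X) (g : SL(2, ℝ)) :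
    lieDeriv T γ (lieDeriv T γ (T g v)) =
      T g (B ((g⁻¹ : SL(2, ℝ)) * X * g) ((g⁻¹ : SL(2, ℝ)) * X * g)) := by
  rw [(hv.mono one_le_two).lieDeriv_apply hγ,
    IsCkVector.lieDeriv_apply (hv.lieDeriv (hγ.conj g)) hγ,
    hJ.lieDeriv_lieDeriv_eq (hγ.conj g) (hγ.conj g)]

end IsTwoJet

theorem IsCkVector.casimir_apply {v : H} (hv : IsCkVector T 2 v) (g : SL(2, ℝ)) :
    casimir T (T g v) = T g (casimir T v) := by
  obtain ⟨D, B, hJ⟩ := hv.exists_isTwoJet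
  rw [hJ.casimir_eq, ← casimirForm_conj B g]
  simp only [casimir, hJ.lieDeriv_lieDeriv_apply hv isOneParam_hyp,
    hJ.lieDeriv_lieDeriv_apply hv isOneParam_diag, hJ.lieDeriv_lieDeriv_apply hv isOneParam_rot,
    map_smul, map_add, map_sub]

theorem lieDeriv_rot {m : ℤ} {v : H} (hv : v ∈ kTypeSpace T m) :
    lieDeriv T rot v = (Complex.I * m) • v := by
  have h : HasDerivAt (fun θ : ℝ => Complex.I * m * (θ : ℂ)) (Complex.I * m) 0 := by
    simpa using (Complex.ofRealCLM.hasDerivAt (x := 0)).const_mul (Complex.I * m)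
  refine HasDerivAt.deriv ((h.cexp.smul_const v).congr_of_eventuallyEq
    (.of_forall fun θ => hv θ) |>.congr_deriv ?_)
  simp

theorem inner_lieDeriv_rot {n : ℤ} {u w : H} (hw : w ∈ kTypeSpace T n) (hw' : IsCkVector T 1 w)
    (hu : IsCkVector T 1 u) :
    inner ℂ w (lieDeriv T rot u) = Complex.I * n * inner ℂ w u := by
  rw [← neg_eq_iff_eq_neg.2 (inner_lieDeriv hw' hu isOneParam_rot), lieDeriv_rot hw,
    inner_smul_left]
  simp

theorem conj_diag_matW (t : ℝ) : (((diag t)⁻¹ : SL(2, ℝ)) : Mat2) * matW * diag t =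
    Real.cosh (2 * t) • matW - Real.sinh (2 * t) • matV := by
  rw [← isOneParam_diag.neg]
  ext i j
  fin_cases i <;> fin_cases j <;>
    simp [diag, matW, matV, Matrix.mul_apply, Fin.sum_univ_two, ← Real.exp_add,
      Real.cosh_eq, Real.sinh_eq] <;> ring_nf

section RadialPart

variable {n m : ℤ} {v w : H} {t : ℝ}

theorem inner_apply_diag_lieDeriv_conj (hw : w ∈ kTypeSpace T n) (hw' : IsCkVector T 1 w)
    (hv : IsCkVector T 1 v) :
    inner ℂ w (T (diag t) (lieDeriv T (fun θ => (diag t)⁻¹ * rot θ * diag t) v)) =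
      Complex.I * n * inner ℂ w (T (diag t) v) := by
  rw [← hv.lieDeriv_apply isOneParam_rot, inner_lieDeriv_rot hw hw' (hv.apply _)]

theorem IsTwoJet.sinh_sq_smul_apply_matV {D : Mat2 →ₗ[ℝ] H} {B : Mat2 →ₗ[ℝ] Mat2 →ₗ[ℝ] H}
    (hJ : IsTwoJet T v D B) {X : Mat2} {c s : ℝ} (hX : X = c • matW - s • matV) :
    s ^ 2 • B matV matV =
      c ^ 2 • B matW matW - (2 * c) • B X matW + (2 * c * s) • D matQ + B X X := by
  have hWV : matW * matV - matV * matW = (2 : ℝ) • matQ := by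
    ext i j; fin_cases i <;> fin_cases j <;> norm_num [matW, matV, matQ]
  have h := hJ.sub_swap matW matV
  rw [hWV, map_smul, sub_eq_iff_eq_add] at h
  simp only [hX, map_sub, map_smul, LinearMap.sub_apply, LinearMap.smul_apply, h]
  module

theorem lieDeriv_lieDeriv_rot (hv : v ∈ kTypeSpace T m) :
    lieDeriv T rot (lieDeriv T rot v) = -(m ^ 2 : ℂ) • v := by
  rw [lieDeriv_rot hv, lieDeriv_rot (Submodule.smul_mem _ _ hv), smul_smul]
  congr 1
  linear_combination (m : ℂ) ^ 2 * Complex.I_sq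

/-- The Lie derivative along `W` from the left and from the right acts on the matrix coefficient by
the scalars `i n` and `i m`, and `V` is a combination of `W` and its conjugate by `diag t`. -/
theorem sinh_sq_mul_inner_diag_lieDeriv_hyp (hv : v ∈ kTypeSpace T m) (hv' : IsCkVector T 2 v)
    (hw : w ∈ kTypeSpace T n) (hw' : IsCkVector T 1 w) :
    (Real.sinh (2 * t) ^ 2 : ℝ) * inner ℂ w (T (diag t) (lieDeriv T hyp (lieDeriv T hyp v))) =
      (2 * m * n * Real.cosh (2 * t) - m ^ 2 * Real.cosh (2 * t) ^ 2 - n ^ 2 : ℝ) *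
        inner ℂ w (T (diag t) v) +
      (2 * Real.cosh (2 * t) * Real.sinh (2 * t) : ℝ) *
        inner ℂ w (T (diag t) (lieDeriv T diag v)) := by
  obtain ⟨D, B, hJ⟩ := hv'.exists_isTwoJet
  have hγ := isOneParam_rot.conj (diag t)
  set X : Mat2 := ((diag t)⁻¹ : SL(2, ℝ)) * matW * diag t
  have hX : X = _ := conj_diag_matW t
  let ℓ : H →ₗ[ℝ] ℂ := ((innerSL ℂ w).toLinearMap ∘ₗ
    (T (diag t)).toLinearEquiv.toLinearMap).restrictScalars ℝ
  have hℓ (u : H) : ℓ u = inner ℂ w (T (diag t) u) := rfl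
  have hXW : ℓ (B X matW) = -(n * m * ℓ v) := by
    rw [← hJ.lieDeriv_lieDeriv_eq hγ isOneParam_rot, hℓ, inner_apply_diag_lieDeriv_conj hw hw'
      (hv'.lieDeriv isOneParam_rot), lieDeriv_rot hv, map_smul, inner_smul_right, hℓ]
    linear_combination n * m * inner ℂ w (T (diag t) v) * Complex.I_sq
  have hWW : ℓ (B matW matW) = -(m ^ 2 * ℓ v) := by
    rw [← hJ.lieDeriv_lieDeriv_eq isOneParam_rot isOneParam_rot, lieDeriv_lieDeriv_rot hv, hℓ,
      map_smul, inner_smul_right, hℓ, neg_mul]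
  have hXX : ℓ (B X X) = -(n ^ 2 * ℓ v) := by
    rw [← hJ.lieDeriv_lieDeriv_eq hγ hγ, hℓ, inner_apply_diag_lieDeriv_conj hw hw'
      (hv'.lieDeriv hγ), inner_apply_diag_lieDeriv_conj hw hw' (hv'.mono one_le_two), hℓ]
    linear_combination n ^ 2 * inner ℂ w (T (diag t) v) * Complex.I_sq
  have hV := congrArg ℓ (hJ.sinh_sq_smul_apply_matV hX)
  simp only [map_add, map_sub, map_smul, Complex.real_smul, hXW, hWW, hXX] at hV
  rw [hJ.lieDeriv_lieDeriv_eq isOneParam_hyp isOneParam_hyp, hJ.lieDeriv_eq isOneParam_diag,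
    ← hℓ, ← hℓ, ← hℓ, hV]
  push_cast
  ring

theorem inner_diag_lieDeriv_lieDeriv {lam : ℝ} (hlam : IsCasimirParameter T lam)
    (hv : v ∈ kTypeSpace T m) (hv' : IsCkVector T 2 v) (hw : w ∈ kTypeSpace T n)
    (hw' : IsCkVector T 1 w) (ht : t ≠ 0) :
    inner ℂ w (T (diag t) (lieDeriv T diag (lieDeriv T diag v))) =
      (4 * lam + (n ^ 2 + m ^ 2 - 2 * m * n * Real.cosh (2 * t)) / Real.sinh (2 * t) ^ 2 : ℝ) *
        inner ℂ w (T (diag t) v) -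
      (2 * (Real.cosh (2 * t) / Real.sinh (2 * t)) : ℝ) *
        inner ℂ w (T (diag t) (lieDeriv T diag v)) := by
  have hΩ := congrArg (inner ℂ w ∘ T (diag t)) (hlam v hv')
  simp only [casimir, lieDeriv_lieDeriv_rot hv, Function.comp_apply, map_smul, map_add, map_sub,
    inner_smul_right, inner_add_right, inner_sub_right] at hΩ
  have hV := sinh_sq_mul_inner_diag_lieDeriv_hyp (t := t) hv hv' hw hw'
  have hs : (Real.sinh (2 * t) : ℂ) ≠ 0 := by
    exact_mod_cast mt Real.sinh_eq_zero.1 (mul_ne_zero two_ne_zero ht)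
  have hcs : (Real.cosh (2 * t) : ℂ) ^ 2 - (Real.sinh (2 * t) : ℂ) ^ 2 = 1 := by
    exact_mod_cast Real.cosh_sq_sub_sinh_sq (2 * t)
  push_cast at hs hcs hV ⊢
  field_simp
  linear_combination 4 * Complex.sinh (2 * t) ^ 2 * hΩ - hV +
    (m : ℂ) ^ 2 * inner ℂ w (T (diag t) v) * hcs

end RadialPart

/-! ### Gårding vectors -/

section ParametricIntegrals

open MeasureTheory

variable {X G P E E' F : Type*} [NormedAddCommGroup E] [NormedSpace ℝ E]
  [NormedAddCommGroup E'] [NormedSpace ℝ E'] [NormedAddCommGroup F] [NormedSpace ℝ F]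
  [NormedAddCommGroup P] [NormedSpace ℝ P]

theorem contDiffOn_integral_of_isClosedEmbedding [TopologicalSpace X] [MeasurableSpace X]
    [BorelSpace X] {μ : Measure X} [NormedAddCommGroup G] [NormedSpace ℝ G]
    [FiniteDimensional ℝ G] {ι : X → G} (hι : IsClosedEmbedding ι) {f : X → E}
    (hf : LocallyIntegrable f μ) (L : E →L[ℝ] E' →L[ℝ] F) {k : ℕ} {g : P → G → E'} {s : Set P}
    (hs : IsOpen s) {K : Set G} (hK : IsCompact K) (hgK : ∀ p ∈ s, ∀ y ∉ K, g p y = 0)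
    (hg : ContDiffOn ℝ k ↿g (s ×ˢ Set.univ)) :
    ContDiffOn ℝ k (fun p => ∫ x, L (f x) (g p (ι x)) ∂μ) s := by
  borelize G
  have : ProperSpace G := FiniteDimensional.proper_real G
  have hι' := hι.measurableEmbedding
  have hf' : LocallyIntegrable (Function.extend ι f 0) (μ.map ι) :=
    locallyIntegrable_iff.2 fun C hC => (hι'.integrableOn_map_iff).2 <| by
      rw [Function.extend_comp hι.injective]
      exact hf.integrableOn_isCompact (hι.isCompact_preimage hC)
  have h := contDiffOn_convolution_right_with_param_comp (n := k) L (v := fun _ : P => (0 : G))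
    contDiffOn_const hs hK.neg (g := fun p y => g p (-y))
    (fun p y hp hy => hgK p hp _ (by simpa using hy)) hf'
    (hg.comp (contDiff_fst.prodMk contDiff_snd.neg).contDiffOn fun q hq => ⟨hq.1, trivial⟩)
  refine h.congr fun p _ => ?_
  simp [convolution, hι'.integral_map, hι.injective.extend_apply]

theorem contDiffAt_intervalIntegral {k : ℕ} {g : P → ℝ → F} {p₀ : P}
    (hg : ∀ x, ContDiffAt ℝ k ↿g (p₀, x)) (a b : ℝ) :
    ContDiffAt ℝ k (fun p => ∫ x in a..b, g p x) p₀ := by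
  let χ : ContDiffBump ((a + b) / 2) :=
    ⟨|b - a| / 2 + 1, |b - a| / 2 + 2, by positivity, by linarith⟩
  have hχ : ∀ x ∈ Set.uIoc a b, χ x = 1 := fun x hx => χ.one_of_mem_closedBall <| by
    rw [Set.uIoc, Set.mem_Ioc] at hx
    rw [Metric.mem_closedBall, Real.dist_eq]
    change |x - (a + b) / 2| ≤ |b - a| / 2 + 1
    grind
  have hcompact := isCompact_closedBall ((a + b) / 2) χ.rOut
  have hnear : ∀ᶠ p in 𝓝 p₀, ∀ x ∈ Metric.closedBall ((a + b) / 2) χ.rOut,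
      ContDiffAt ℝ k ↿g (p, x) :=
    hcompact.eventually_forall_of_forall_eventually fun x _ => (hg x).eventually (by simp)
  obtain ⟨s, hsg, hs, hps⟩ := eventually_nhds_iff.1 hnear
  have hsmooth : ContDiffOn ℝ k ↿(fun p x => χ x • g p x) (s ×ˢ Set.univ) := fun q hq => by
    refine ContDiffAt.contDiffWithinAt ?_
    by_cases hx : q.2 ∈ Metric.closedBall ((a + b) / 2) χ.rOut
    · exact (χ.contDiff.comp contDiff_snd).contDiffAt.smul (hsg q.1 hq.1 q.2 hx)
    · have h : ∀ᶠ x in 𝓝 q.2, χ x = 0 :=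
        notMem_tsupport_iff_eventuallyEq.1 (χ.tsupport_eq ▸ hx)
      refine (contDiffAt_const (c := (0 : F))).congr_of_eventuallyEq ?_
      filter_upwards [continuous_snd.continuousAt.eventually h] with r hr
      exact (congrArg (· • g r.1 r.2) hr).trans (zero_smul ℝ _)
  have h := contDiffOn_integral_of_isClosedEmbedding (μ := volume.restrict (Set.uIoc a b))
    (f := fun _ : ℝ => (1 : ℝ)) .id (locallyIntegrable_const 1) (ContinuousLinearMap.lsmul ℝ ℝ)
    hs hcompact (fun p _ x hx => ?_) hsmooth
  · simp only [intervalIntegral.intervalIntegral_eq_integral_uIoc]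
    refine ((h.contDiffAt (hs.mem_nhds hps)).const_smul _).congr_of_eventuallyEq
      (.of_forall fun p => congrArg _ (setIntegral_congr_fun measurableSet_uIoc fun x hx => ?_))
    simp [hχ x hx]
  · have hχx : χ x = 0 := χ.zero_of_le_dist (by simpa using (not_le.1 hx).le)
    simp [hχx]

end ParametricIntegrals

section Garding

open MeasureTheory

theorem contDiff_adjugate {k : WithTop ℕ∞} : ContDiff ℝ k fun A : Mat2 => A.adjugate := by
  let L : Mat2 →ₗ[ℝ] Mat2 := (Matrix.traceLinearMap (Fin 2) ℝ ℝ).smulRight 1 - LinearMap.id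
  have h : (fun A : Mat2 => A.adjugate) = L.toContinuousLinearMap := by
    ext A i j
    fin_cases i <;> fin_cases j <;>
      simp [L, Matrix.adjugate_fin_two, Matrix.trace_fin_two]
  rw [h]
  exact L.toContinuousLinearMap.contDiff

theorem isClosedEmbedding_coe : IsClosedEmbedding fun g : SL(2, ℝ) => (g : Mat2) :=
  Matrix.SpecialLinearGroup.isClosedEmbedding_val

instance : LocallyCompactSpace SL(2, ℝ) :=
  have : LocallyCompactSpace Mat2 := inferInstanceAs (LocallyCompactSpace (Fin 2 → Fin 2 → ℝ))
  isClosedEmbedding_coe.locallyCompactSpace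

instance : SecondCountableTopology SL(2, ℝ) :=
  have : SecondCountableTopology Mat2 :=
    inferInstanceAs (SecondCountableTopology (Fin 2 → Fin 2 → ℝ))
  isClosedEmbedding_coe.isInducing.secondCountableTopology

theorem apply_real_smul (g : SL(2, ℝ)) (c : ℝ) (v : H) : T g (c • v) = c • T g v :=
  (T g).toLinearEquiv.toLinearMap.map_smul_of_tower c v

section HaarMeasure

variable [MeasurableSpace SL(2, ℝ)] [BorelSpace SL(2, ℝ)] {μ : Measure SL(2, ℝ)}

/-- The adjugate extends inversion on `SL(2, ℝ)` to a smooth map on all matrices. -/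
theorem contDiffAt_integral_adjugate_mul {E : Type*} [NormedAddCommGroup E] [NormedSpace ℝ E]
    {k : ℕ} {f : Mat2 → ℝ} (hf : ContDiff ℝ k f) (hf' : HasCompactSupport f)
    {Ψ : SL(2, ℝ) → E} (hΨ : LocallyIntegrable Ψ μ) {A₀ : Mat2} (hA₀ : A₀.det ≠ 0) :
    ContDiffAt ℝ k (fun A : Mat2 => ∫ g : SL(2, ℝ), f (A.adjugate * g) • Ψ g ∂μ) A₀ := by
  obtain ⟨R, hR⟩ := hf'.isCompact.isBounded.exists_norm_le
  let s : Set Mat2 := {A | |A₀.det| / 2 < |A.det|} ∩ {A | ‖A‖ < ‖A₀‖ + 1}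
  have hs : IsOpen s := (isOpen_lt continuous_const continuous_id.matrix_det.abs).inter
    (isOpen_lt continuous_norm continuous_const)
  have hA₀s : A₀ ∈ s := ⟨half_lt_self (abs_pos.2 hA₀), lt_add_one ‖A₀‖⟩
  refine (contDiffOn_integral_of_isClosedEmbedding isClosedEmbedding_coe hΨ
    (ContinuousLinearMap.lsmul ℝ ℝ).flip (k := k) hs
    (isCompact_closedBall 0 ((‖A₀‖ + 1) * R / (|A₀.det| / 2)))
    (g := fun A Y => f (A.adjugate * Y)) (fun A hA Y hY => ?_) ?_).contDiffAt (hs.mem_nhds hA₀s)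
  · by_contra hne
    refine hY (mem_closedBall_zero_iff.2 ((le_div_iff₀ (by positivity)).2 ?_))
    calc ‖Y‖ * (|A₀.det| / 2) ≤ |A.det| * ‖Y‖ := by
          rw [mul_comm]; exact mul_le_mul_of_nonneg_right hA.1.le (norm_nonneg Y)
      _ = ‖A * (A.adjugate * Y)‖ := by
          rw [← mul_assoc, Matrix.mul_adjugate, smul_mul_assoc, one_mul, norm_smul,
            Real.norm_eq_abs]
      _ ≤ ‖A‖ * ‖A.adjugate * Y‖ := norm_mul_le _ _
      _ ≤ (‖A₀‖ + 1) * R := mul_le_mul hA.2.le (hR _ (subset_tsupport f hne)) (norm_nonneg _)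
          (by positivity)
  · exact (hf.comp ((contDiff_adjugate.comp contDiff_fst).mul contDiff_snd)).contDiffOn

/-- The Gårding vector `T(f) v`, the average of the orbit of `v` with weight `f`. -/
noncomputable def gardingVector (T : SL(2, ℝ) →* (H ≃ₗᵢ[ℂ] H)) (μ : Measure SL(2, ℝ))
    (f : Mat2 → ℝ) (v : H) : H :=
  ∫ g : SL(2, ℝ), f g • T g v ∂μ

theorem isCkVector_gardingVector [CompleteSpace H] [μ.IsHaarMeasure]
    (hT : IsStronglyContinuous T) {k : ℕ} {f : Mat2 → ℝ} (hf : ContDiff ℝ k f)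
    (hf' : HasCompactSupport f) (v : H) : IsCkVector T k (gardingVector T μ f v) := by
  refine isCkVector_iff.2
    ⟨fun A => ∫ g : SL(2, ℝ), f (A.adjugate * g) • T g v ∂μ, fun h => ⟨?_, ?_⟩⟩
  · exact contDiffAt_integral_adjugate_mul hf hf' (hT v).locallyIntegrable (by simp)
  · rw [gardingVector, ← integral_mul_left_eq_self _ h⁻¹]
    refine Eq.trans (integral_congr_ae (.of_forall fun g => ?_))
      ((T h).toContinuousLinearEquiv.integral_comp_comm _)
    change _ = T h (f (h⁻¹ * g : SL(2, ℝ)) • T (h⁻¹ * g) v)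
    rw [apply_real_smul]
    simp [map_mul, Matrix.SpecialLinearGroup.coe_inv]

theorem inner_gardingVector_pos [CompleteSpace H] [μ.IsHaarMeasure]
    (hT : IsStronglyContinuous T) {f : Mat2 → ℝ} (hf : Continuous f) (hf' : HasCompactSupport f)
    (hf₀ : ∀ A, 0 ≤ f A) (hf₁ : f 1 ≠ 0) {v : H}
    (hfv : ∀ g : SL(2, ℝ), f g ≠ 0 → 0 < RCLike.re (inner ℂ v (T g v))) :
    0 < RCLike.re (inner ℂ v (gardingVector T μ f v)) := by
  have hcont : Continuous fun g : SL(2, ℝ) => f g := hf.comp isClosedEmbedding_coe.continuous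
  have hcpt : HasCompactSupport fun g : SL(2, ℝ) => f g :=
    hf'.comp_isClosedEmbedding isClosedEmbedding_coe
  have hint : Integrable (fun g : SL(2, ℝ) => f g • T g v) μ :=
    (hcont.smul (hT v)).integrable_of_hasCompactSupport hcpt.smul_right
  have heq : RCLike.re (inner ℂ v (gardingVector T μ f v)) =
      ∫ g : SL(2, ℝ), f g * RCLike.re (inner ℂ v (T g v)) ∂μ := by
    rw [gardingVector, ← integral_inner hint, ← integral_re (hint.const_inner v)]
    simp only [inner_smul_right_eq_smul, RCLike.smul_re]
  have hnonneg : ∀ g : SL(2, ℝ), 0 ≤ f g * RCLike.re (inner ℂ v (T g v)) := fun g => by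
    rcases eq_or_ne (f g) 0 with h | h
    · simp [h]
    · exact mul_nonneg (hf₀ g) (hfv g h).le
  rw [heq]
  refine Continuous.integral_pos_of_hasCompactSupport_nonneg_nonzero (x := 1)
    (hcont.mul (RCLike.continuous_re.comp (continuous_const.inner (hT v)))) hcpt.mul_right
    hnonneg ?_
  exact mul_ne_zero (by simpa using hf₁) (hfv 1 (by simpa using hf₁)).ne'

end HaarMeasure

theorem exists_isCkVector_inner_ne_zero [CompleteSpace H] (hT : IsStronglyContinuous T) (k : ℕ)
    {v : H} (hv : v ≠ 0) : ∃ u, IsCkVector T k u ∧ inner ℂ v u ≠ 0 := by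
  borelize SL(2, ℝ)
  have hc : Continuous fun g => RCLike.re (inner ℂ v (T g v)) :=
    RCLike.continuous_re.comp (continuous_const.inner (hT v))
  have hc₁ : 0 < RCLike.re (inner ℂ v (T 1 v)) := by
    rw [map_one, LinearIsometryEquiv.coe_one, id_eq, inner_self_eq_norm_sq]
    positivity
  obtain ⟨U, hU, hUv⟩ : ∃ U ∈ 𝓝 (1 : Mat2), ∀ g : SL(2, ℝ), (g : Mat2) ∈ U →
      0 < RCLike.re (inner ℂ v (T g v)) := by
    have h := hc.continuousAt.eventually (lt_mem_nhds hc₁)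
    rw [isClosedEmbedding_coe.nhds_eq_comap] at h
    exact h
  obtain ⟨f, hfU, hf', hf, hf₀, hf₁⟩ := exists_contDiff_tsupport_subset (n := k) hU
  refine ⟨gardingVector T Measure.haar f v, isCkVector_gardingVector hT hf hf' v, fun h => ?_⟩
  have hpos := inner_gardingVector_pos (μ := Measure.haar) hT hf.continuous hf'
    (fun A => (hf₀ (Set.mem_range_self A)).1) (by simp [hf₁])
    fun g hg => hUv g (hfU (subset_tsupport f hg))
  simp [h] at hpos

end Garding

section KTypeProjection

theorem contDiff_rot {k : WithTop ℕ∞} : ContDiff ℝ k fun θ => (rot θ : Mat2) := by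
  have h : (fun θ => (rot θ : Mat2)) = fun θ => Real.cos θ • (1 : Mat2) + Real.sin θ • matW := by
    ext θ i j
    fin_cases i <;> fin_cases j <;> simp [rot, matW]
  rw [h]
  exact (Real.contDiff_cos.smul contDiff_const).add (Real.contDiff_sin.smul contDiff_const)

theorem continuous_rot : Continuous rot :=
  isClosedEmbedding_coe.isInducing.continuous_iff.2 (contDiff_rot (k := 0)).continuous

/-- The projection `(2π)⁻¹ ∫ e^{-inθ} T(r(θ)) u dθ` of `u` to the `K`-type `n`. -/
noncomputable def kTypeProj (T : SL(2, ℝ) →* (H ≃ₗᵢ[ℂ] H)) (n : ℤ) (u : H) : H :=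
  (2 * Real.pi)⁻¹ • ∫ θ in (0)..(2 * Real.pi), Complex.exp (-(Complex.I * n * θ)) • T (rot θ) u

theorem inner_rot_right {n : ℤ} {v : H} (hv : v ∈ kTypeSpace T n) (θ : ℝ) (w : H) :
    inner ℂ v (T (rot θ) w) = Complex.exp (Complex.I * n * θ) * inner ℂ v w := by
  rw [inner_apply_right, ← isOneParam_rot.neg, hv, inner_smul_left, ← Complex.exp_conj]
  simp

theorem apply_intervalIntegral (g : SL(2, ℝ)) (f : ℝ → H) (a b : ℝ) :
    T g (∫ θ in a..b, f θ) = ∫ θ in a..b, T g (f θ) := by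
  simp only [intervalIntegral.intervalIntegral_eq_integral_uIoc]
  rw [apply_real_smul]
  exact congrArg _ ((T g).toContinuousLinearEquiv.integral_comp_comm f).symm

theorem apply_kTypeProj (g : SL(2, ℝ)) (n : ℤ) (u : H) :
    T g (kTypeProj T n u) = (2 * Real.pi)⁻¹ • ∫ θ in (0)..(2 * Real.pi),
      Complex.exp (-(Complex.I * n * θ)) • T (g * rot θ) u := by
  rw [kTypeProj, apply_real_smul, apply_intervalIntegral]
  simp [map_mul]

theorem kTypeProj_mem (n : ℤ) (u : H) : kTypeProj T n u ∈ kTypeSpace T n := by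
  intro φ
  let f : ℝ → H := fun θ => Complex.exp (-(Complex.I * n * θ)) • T (rot θ) u
  have hf : Function.Periodic f (2 * Real.pi) := fun θ => by
    have hrot : rot (θ + 2 * Real.pi) = rot θ := Subtype.ext (by simp [rot])
    have hexp : Complex.exp (-(Complex.I * n * ↑(θ + 2 * Real.pi))) =
        Complex.exp (-(Complex.I * n * θ)) :=
      Complex.exp_eq_exp_iff_exists_int.2 ⟨-n, by push_cast; ring⟩
    simp only [f, hrot, hexp]
  have hshift : ∀ θ : ℝ, Complex.exp (-(Complex.I * n * θ)) • T (rot φ * rot θ) u =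
      Complex.exp (Complex.I * n * φ) • f (φ + θ) := fun θ => by
    simp only [f, isOneParam_rot.add, smul_smul, ← Complex.exp_add]
    congr 2
    push_cast
    ring
  calc T (rot φ) (kTypeProj T n u)
      = (2 * Real.pi)⁻¹ • Complex.exp (Complex.I * n * φ) •
          ∫ θ in φ..(φ + 2 * Real.pi), f θ := by
        simp only [apply_kTypeProj, hshift, intervalIntegral.integral_smul,
          intervalIntegral.integral_comp_add_left, add_zero]
    _ = Complex.exp (Complex.I * n * φ) • kTypeProj T n u := by
        rw [hf.intervalIntegral_add_eq φ 0, zero_add, smul_comm, kTypeProj]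

theorem inner_kTypeProj [CompleteSpace H] (hT : IsStronglyContinuous T) {n : ℤ} {v : H}
    (hv : v ∈ kTypeSpace T n) (u : H) : inner ℂ v (kTypeProj T n u) = inner ℂ v u := by
  have hcont : Continuous fun θ : ℝ => Complex.exp (-(Complex.I * n * θ)) • T (rot θ) u :=
    (by fun_prop : Continuous fun θ : ℝ => Complex.exp (-(Complex.I * n * θ))).smul
      ((hT u).comp continuous_rot)
  have hconst : ∀ θ : ℝ, inner ℂ v (Complex.exp (-(Complex.I * n * θ)) • T (rot θ) u) =
      inner ℂ v u := fun θ => by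
    rw [inner_smul_right, inner_rot_right hv, ← mul_assoc, ← Complex.exp_add, neg_add_cancel,
      Complex.exp_zero, one_mul]
  have hint := (innerSL ℂ v).intervalIntegral_comp_comm
    (hcont.intervalIntegrable (μ := MeasureTheory.volume) 0 (2 * Real.pi))
  simp only [innerSL_apply_apply, hconst, intervalIntegral.integral_const] at hint
  rw [kTypeProj, inner_smul_right_eq_smul, ← hint, sub_zero, smul_smul,
    inv_mul_cancel₀ (by positivity), one_smul]

theorem IsCkVector.kTypeProj {k : ℕ} {u : H} (hu : IsCkVector T k u) (n : ℤ) :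
    IsCkVector T k (kTypeProj T n u) := by
  obtain ⟨F, hF⟩ := isCkVector_iff.1 hu
  refine isCkVector_iff.2 ⟨fun A => (2 * Real.pi)⁻¹ • ∫ θ in (0)..(2 * Real.pi),
    Complex.exp (-(Complex.I * n * θ)) • F (A * rot θ), fun g => ⟨?_, ?_⟩⟩
  · refine (contDiffAt_intervalIntegral (fun θ => ?_) 0 (2 * Real.pi)).const_smul _
    have hθ := (hF (g * rot θ)).1
    rw [Matrix.SpecialLinearGroup.coe_mul] at hθ
    refine ContDiffAt.smul ?_ (hθ.comp ((g : Mat2), θ)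
      (contDiff_fst.mul (contDiff_rot.comp contDiff_snd)).contDiffAt)
    have hexp : ContDiff ℝ k fun θ : ℝ => Complex.exp (-(Complex.I * n * θ)) :=
      (contDiff_const.mul Complex.ofRealCLM.contDiff).neg.cexp
    exact (hexp.comp contDiff_snd).contDiffAt
  · rw [apply_kTypeProj]
    simp only [← Matrix.SpecialLinearGroup.coe_mul, (hF _).2]

theorem isCkVector_of_finrank_eq_one [CompleteSpace H] (hT : IsStronglyContinuous T) (k : ℕ)
    {n : ℤ} (hn : Module.finrank ℂ (kTypeSpace T n) = 1) {v : H} (hv : v ∈ kTypeSpace T n) :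
    IsCkVector T k v := by
  rcases eq_or_ne v 0 with rfl | hv₀
  · exact ⟨fun _ => 0, fun g => ⟨contDiffAt_const, by simp⟩⟩
  obtain ⟨u, hu, hvu⟩ := exists_isCkVector_inner_ne_zero hT k hv₀
  have hne : (⟨kTypeProj T n u, kTypeProj_mem n u⟩ : kTypeSpace T n) ≠ 0 := fun h => hvu <| by
    rw [← inner_kTypeProj hT hv, show kTypeProj T n u = 0 from congrArg Subtype.val h,
      inner_zero_right]
  obtain ⟨c, hc⟩ := (finrank_eq_one_iff_of_nonzero' _ hne).1 hn ⟨v, hv⟩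
  rw [← show c • kTypeProj T n u = v from congrArg Subtype.val hc]
  exact (hu.kTypeProj n).smul c

end KTypeProjection

/-! ### The Casimir parameter -/

theorem IsIrreducible.eq_zero_of_forall_inner_apply_eq_zero (hirr : IsIrreducible T) {u : H}
    (hu : u ≠ 0) {w : H} (hw : ∀ g, inner ℂ (T g u) w = 0) : w = 0 := by
  let S : Submodule ℂ H := ⨅ g : SL(2, ℝ), (innerSL ℂ (T g u)).toLinearMap.ker
  have mem_S : ∀ x, x ∈ S ↔ ∀ g, inner ℂ (T g u) x = 0 := fun x => by
    simp [S, Submodule.mem_iInf, LinearMap.mem_ker]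
  have hclosed : IsClosed (S : Set H) := by
    have hS : (S : Set H) = ⋂ g : SL(2, ℝ), {x | inner ℂ (T g u) x = 0} := by
      ext x
      simp [mem_S]
    rw [hS]
    exact isClosed_iInter fun g => isClosed_eq (by fun_prop) continuous_const
  have hinv : ∀ g : SL(2, ℝ), ∀ v ∈ S, T g v ∈ S := fun g v hv => by
    rw [mem_S] at hv ⊢
    intro h
    rw [inner_apply_right, ← hv (g⁻¹ * h), map_mul]
    rfl
  rcases hirr.2 S hclosed hinv with h | h
  · exact (Submodule.mem_bot ℂ).1 (h ▸ (mem_S w).2 hw)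
  · have huu : inner ℂ (T 1 u) u = 0 := (mem_S u).1 (h ▸ Submodule.mem_top) 1
    rw [map_one] at huu
    exact absurd (inner_self_eq_zero.1 huu) hu

theorem IsCkVector.lieDeriv_smul {v : H} (hv : IsCkVector T 1 v) {γ : ℝ → SL(2, ℝ)} {X : Mat2}
    (hγ : IsOneParam γ X) (c : ℂ) :
    Ratner.lieDeriv T γ (c • v) = c • Ratner.lieDeriv T γ v := by
  refine HasDerivAt.deriv (((hv.hasDerivAt_zero hγ).const_smul c).congr_of_eventuallyEq
    (.of_forall fun s => ?_))
  simp

theorem IsCkVector.casimir_smul {v : H} (hv : IsCkVector T 2 v) (c : ℂ) :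
    casimir T (c • v) = c • casimir T v := by
  have hv₁ := hv.mono one_le_two
  have hW : IsCkVector T 1 (Ratner.lieDeriv T rot v) := hv.lieDeriv isOneParam_rot
  have hQ : IsCkVector T 1 (Ratner.lieDeriv T diag v) := hv.lieDeriv isOneParam_diag
  have hV : IsCkVector T 1 (Ratner.lieDeriv T hyp v) := hv.lieDeriv isOneParam_hyp
  simp only [casimir, hv₁.lieDeriv_smul isOneParam_rot, hv₁.lieDeriv_smul isOneParam_diag,
    hv₁.lieDeriv_smul isOneParam_hyp, hW.lieDeriv_smul isOneParam_rot,
    hQ.lieDeriv_smul isOneParam_diag, hV.lieDeriv_smul isOneParam_hyp]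
  module

theorem IsCkVector.casimir_mem_kTypeSpace {n : ℤ} {v : H} (hv : IsCkVector T 2 v)
    (hn : v ∈ kTypeSpace T n) : casimir T v ∈ kTypeSpace T n := fun θ => by
  rw [← hv.casimir_apply, hn θ, hv.casimir_smul]

namespace IsKTypeBasis

variable {φ : ℤ → H}

theorem exists_ne_zero [Nontrivial H] (hφ : IsKTypeBasis T φ) : ∃ n, φ n ≠ 0 := by
  by_contra! h
  have hspan : Submodule.span ℂ (Set.range φ) = ⊥ :=
    Submodule.span_eq_bot.2 (Set.forall_mem_range.2 h)
  have htotal := hφ.total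
  rw [hspan, (by simp : IsClosed ((⊥ : Submodule ℂ H) : Set H)).submodule_topologicalClosure_eq]
    at htotal
  exact bot_ne_top htotal

theorem isCkVector [CompleteSpace H] (hφ : IsKTypeBasis T φ) (hT : IsStronglyContinuous T)
    (k : ℕ) (n : ℤ) : IsCkVector T k (φ n) := by
  rcases eq_or_ne (φ n) 0 with h | h
  · rw [h]
    exact ⟨fun _ => 0, fun g => ⟨contDiffAt_const, by simp⟩⟩
  · exact isCkVector_of_finrank_eq_one hT k ((hφ.ne_zero_iff n).1 h) (hφ.mem n)

theorem norm_eq_one (hφ : IsKTypeBasis T φ) {n : ℤ} (h : φ n ≠ 0) : ‖φ n‖ = 1 :=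
  hφ.orthonormal.1 ⟨n, h⟩

theorem norm_le_one (hφ : IsKTypeBasis T φ) (n : ℤ) : ‖φ n‖ ≤ 1 := by
  rcases eq_or_ne (φ n) 0 with h | h
  · simp [h]
  · exact (hφ.norm_eq_one h).le

theorem exists_isCasimirParameter [CompleteSpace H] (hφ : IsKTypeBasis T φ)
    (hT : IsStronglyContinuous T) (hirr : IsIrreducible T) :
    ∃ lam : ℝ, IsCasimirParameter T lam := by
  have := hirr.1
  obtain ⟨n, hn⟩ := hφ.exists_ne_zero
  have hC : IsCkVector T 2 (φ n) := hφ.isCkVector hT 2 n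
  have hne : (⟨φ n, hφ.mem n⟩ : kTypeSpace T n) ≠ 0 := fun h => hn (congrArg Subtype.val h)
  obtain ⟨c, hc⟩ := (finrank_eq_one_iff_of_nonzero' _ hne).1 ((hφ.ne_zero_iff n).1 hn)
    ⟨casimir T (φ n), hC.casimir_mem_kTypeSpace (hφ.mem n)⟩
  have hcasimir : casimir T (φ n) = c • φ n := (congrArg Subtype.val hc).symm
  have hreal : starRingEnd ℂ c = c := by
    have h := inner_casimir hC hC
    rw [hcasimir, inner_smul_left, inner_smul_right] at h
    exact mul_right_cancel₀ (inner_self_ne_zero.2 hn) h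
  refine ⟨c.re, fun v hv => ?_⟩
  rw [Complex.conj_eq_iff_re.1 hreal, ← sub_eq_zero]
  refine hirr.eq_zero_of_forall_inner_apply_eq_zero hn fun g => ?_
  rw [inner_sub_right, ← inner_casimir (hC.apply g) hv, hC.casimir_apply, hcasimir, map_smul,
    inner_smul_left, inner_smul_right, hreal, sub_self]

theorem existsUnique_isCasimirParameter [CompleteSpace H] (hφ : IsKTypeBasis T φ)
    (hT : IsStronglyContinuous T) (hirr : IsIrreducible T) :
    ∃! lam : ℝ, IsCasimirParameter T lam := by
  have := hirr.1
  obtain ⟨lam, hlam⟩ := hφ.exists_isCasimirParameter hT hirr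
  refine ⟨lam, hlam, fun mu hmu => ?_⟩
  obtain ⟨n, hn⟩ := hφ.exists_ne_zero
  have hC : IsCkVector T 2 (φ n) := hφ.isCkVector hT 2 n
  exact_mod_cast smul_left_injective ℂ hn ((hmu _ hC).symm.trans (hlam _ hC))

end IsKTypeBasis

theorem inner_lieDeriv_lieDeriv_self {v : H} (hv : IsCkVector T 2 v) {γ : ℝ → SL(2, ℝ)}
    {X : Mat2} (hγ : IsOneParam γ X) :
    inner ℂ v (lieDeriv T γ (lieDeriv T γ v)) = -(‖lieDeriv T γ v‖ : ℂ) ^ 2 := by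
  rw [← neg_eq_iff_eq_neg.2 (inner_lieDeriv (hv.mono one_le_two) (hv.lieDeriv hγ) hγ),
    inner_self_eq_norm_sq_to_K]
  rfl

theorem IsCasimirParameter.norm_lieDeriv_sq_add {lam : ℝ} (hlam : IsCasimirParameter T lam)
    {n : ℤ} {v : H} (hn : v ∈ kTypeSpace T n) (hv : IsCkVector T 2 v) :
    ‖lieDeriv T hyp v‖ ^ 2 + ‖lieDeriv T diag v‖ ^ 2 = (n ^ 2 - 4 * lam) * ‖v‖ ^ 2 := by
  have h := congrArg (inner ℂ v) (hlam v hv)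
  rw [casimir, inner_smul_right, inner_smul_right, inner_sub_right, inner_add_right,
    inner_lieDeriv_lieDeriv_self hv isOneParam_hyp, inner_lieDeriv_lieDeriv_self hv isOneParam_diag,
    lieDeriv_lieDeriv_rot hn, inner_smul_right, inner_self_eq_norm_sq_to_K] at h
  refine Complex.ofReal_injective ?_
  push_cast
  linear_combination -4 * h

theorem IsCasimirParameter.norm_lieDeriv_diag_sq_le {lam : ℝ} (hlam : IsCasimirParameter T lam)
    {n : ℤ} {v : H} (hn : v ∈ kTypeSpace T n) (hv : IsCkVector T 2 v) :
    ‖lieDeriv T diag v‖ ^ 2 ≤ (n ^ 2 - 4 * lam) * ‖v‖ ^ 2 := by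
  rw [← hlam.norm_lieDeriv_sq_add hn hv]
  exact le_add_of_nonneg_left (sq_nonneg _)

/-! ### Decay of matrix coefficients -/

/-- The upper unipotent one-parameter subgroup. -/
def upper (x : ℝ) : SL(2, ℝ) := Matrix.SpecialLinearGroup.transvection zero_ne_one x

/-- The lower unipotent one-parameter subgroup. -/
def lower (x : ℝ) : SL(2, ℝ) := Matrix.SpecialLinearGroup.transvection one_ne_zero x

theorem coe_upper (x : ℝ) : (upper x : Mat2) = !![1, x; 0, 1] := by
  ext i j
  fin_cases i <;> fin_cases j <;> simp [upper, Matrix.SpecialLinearGroup.transvection_coe]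

theorem coe_lower (x : ℝ) : (lower x : Mat2) = !![1, 0; x, 1] := by
  ext i j
  fin_cases i <;> fin_cases j <;> simp [lower, Matrix.SpecialLinearGroup.transvection_coe]

theorem upper_zero : upper 0 = 1 :=
  Matrix.SpecialLinearGroup.transvection_coeff_zero _

theorem lower_zero : lower 0 = 1 :=
  Matrix.SpecialLinearGroup.transvection_coeff_zero _

theorem continuous_upper : Continuous upper := by
  have h : Continuous fun x => (upper x : Mat2) := by
    simp only [coe_upper]
    refine continuous_matrix fun i j => ?_
    fin_cases i <;> fin_cases j
    exacts [continuous_const, continuous_id, continuous_const, continuous_const]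
  exact continuous_induced_rng.2 h

theorem continuous_lower : Continuous lower := by
  have h : Continuous fun x => (lower x : Mat2) := by
    simp only [coe_lower]
    refine continuous_matrix fun i j => ?_
    fin_cases i <;> fin_cases j
    exacts [continuous_const, continuous_const, continuous_id, continuous_const]
  exact continuous_induced_rng.2 h

theorem coe_diag (t : ℝ) : (diag t : Mat2) = !![Real.exp t, 0; 0, Real.exp (-t)] := rfl

theorem exp_mul_exp_neg_two_mul (t : ℝ) : Real.exp t * Real.exp (-2 * t) = Real.exp (-t) := by
  rw [← Real.exp_add]
  ring_nf

theorem upper_mul_diag (x t : ℝ) :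
    upper x * diag t = diag t * upper (x * Real.exp (-2 * t)) := by
  refine Subtype.ext ?_
  simp only [Matrix.SpecialLinearGroup.coe_mul, coe_upper, coe_diag, Matrix.mul_fin_two,
    ← exp_mul_exp_neg_two_mul]
  congr! 2 <;> ring_nf

theorem diag_mul_lower (x t : ℝ) :
    diag t * lower x = lower (x * Real.exp (-2 * t)) * diag t := by
  refine Subtype.ext ?_
  simp only [Matrix.SpecialLinearGroup.coe_mul, coe_lower, coe_diag, Matrix.mul_fin_two,
    ← exp_mul_exp_neg_two_mul]
  congr! 2 <;> ring_nf

theorem upper_mul_lower_mul_upper {s : ℝ} (hs : s ≠ 0) (t : ℝ) :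
    upper ((Real.exp t - 1) / s) * lower s * upper ((Real.exp (-t) - 1) / s) =
      lower (s * Real.exp (-t)) * diag t := by
  have h : Real.exp t * Real.exp (-t) = 1 := by rw [← Real.exp_add, add_neg_cancel, Real.exp_zero]
  refine Subtype.ext ?_
  simp only [Matrix.SpecialLinearGroup.coe_mul, coe_lower, coe_upper, coe_diag, Matrix.mul_fin_two]
  ext i j
  fin_cases i <;> fin_cases j <;> simp <;> field_simp
  exacts [by ring, by linear_combination h, by linear_combination -h, by ring]

theorem tendsto_mul_exp_neg_two_mul (s : ℝ) :
    Tendsto (fun t : ℝ => s * Real.exp (-2 * t)) atTop (𝓝 0) := by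
  have h : Tendsto (fun t : ℝ => -2 * t) atTop atBot :=
    tendsto_id.const_mul_atTop_of_neg (by norm_num)
  simpa using (Real.tendsto_exp_atBot.comp h).const_mul s

theorem exists_weak_limit_of_norm_le [CompleteSpace H] {ι : Type*} (U : Ultrafilter ι) {u : ι → H}
    {C : ℝ} (hu : ∀ i, ‖u i‖ ≤ C) :
    ∃ w : H, ∀ x, Tendsto (fun i => inner ℂ x (u i)) U (𝓝 (inner ℂ x w)) := by
  let f : ι → WeakDual ℂ H := fun i => StrongDual.toWeakDual (InnerProductSpace.toDual ℂ H (u i))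
  have hmem (i : ι) : f i ∈ WeakDual.toStrongDual ⁻¹' Metric.closedBall (0 : StrongDual ℂ H) C := by
    simpa [f] using hu i
  obtain ⟨ℓ, -, hℓ⟩ := (WeakDual.isCompact_closedBall (0 : StrongDual ℂ H) C).ultrafilter_le_nhds
    (U.map f) (le_principal_iff.2 (Filter.mem_map.2 (Filter.univ_mem' hmem)))
  refine ⟨(InnerProductSpace.toDual ℂ H).symm (WeakDual.toStrongDual ℓ), fun x => ?_⟩
  have hx : Tendsto (fun i => f i x) U (𝓝 (ℓ x)) :=
    (WeakDual.eval_continuous x).continuousAt.tendsto.comp hℓ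
  rw [← inner_conj_symm x, InnerProductSpace.toDual_symm_apply]
  refine ((Complex.continuous_conj.tendsto _).comp hx).congr fun i => ?_
  rw [← inner_conj_symm x]
  rfl

theorem apply_mul (g h : SL(2, ℝ)) (v : H) : T (g * h) v = T g (T h v) := by
  rw [map_mul]
  rfl

theorem inner_apply_eq_of_apply_eq_self {g : SL(2, ℝ)} {w : H} (h : T g w = w) (y : H) :
    inner ℂ w (T g y) = inner ℂ w y := by
  conv_lhs => rw [← h]
  exact (T g).inner_map_map w y

theorem apply_eq_self_of_inner_eq {g : SL(2, ℝ)} {w : H}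
    (h : inner ℂ w (T g w) = inner ℂ w w) : T g w = w := by
  have h' : inner ℂ (T g w) w = inner ℂ w w := by
    rw [← inner_conj_symm, h, inner_conj_symm]
  rw [← sub_eq_zero, ← inner_self_eq_zero (𝕜 := ℂ), inner_sub_left, inner_sub_right,
    inner_sub_right, (T g).inner_map_map, h, h', sub_self]

theorem apply_diag_eq_self_of_upper (hT : IsStronglyContinuous T) {w : H}
    (hw : ∀ x, T (upper x) w = w) (t : ℝ) : T (diag t) w = w := by
  refine apply_eq_self_of_inner_eq ?_
  let c (g : SL(2, ℝ)) : ℂ := inner ℂ w (T g w)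
  have hc : Continuous c := continuous_const.inner (hT w)
  have lim_lower : Tendsto (fun s => c (lower s)) (𝓝[≠] 0) (𝓝 (c 1)) := by
    have h := (hc.comp continuous_lower).tendsto 0
    rw [Function.comp_apply, lower_zero] at h
    exact h.mono_left nhdsWithin_le_nhds
  have lim_lower_diag : Tendsto (fun s => c (lower (s * Real.exp (-t)) * diag t)) (𝓝[≠] 0)
      (𝓝 (c (diag t))) := by
    have hγ : Continuous fun s => lower (s * Real.exp (-t)) * diag t :=
      (continuous_lower.comp (continuous_mul_const _)).mul continuous_const
    have h := (hc.comp hγ).tendsto 0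
    rw [Function.comp_apply, zero_mul, lower_zero, one_mul] at h
    exact h.mono_left nhdsWithin_le_nhds
  have c_one : c 1 = inner ℂ w w := by simp [c]
  rw [← c_one]
  refine tendsto_nhds_unique (lim_lower_diag.congr' ?_) lim_lower
  filter_upwards [self_mem_nhdsWithin] with s hs
  simp only [c]
  rw [← upper_mul_lower_mul_upper hs, apply_mul, apply_mul, hw,
    inner_apply_eq_of_apply_eq_self (hw _)]

theorem apply_lower_eq_self_of_diag (hT : IsStronglyContinuous T) {w : H}
    (hw : ∀ t, T (diag t) w = w) (s : ℝ) : T (lower s) w = w := by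
  refine apply_eq_self_of_inner_eq ?_
  have conj (t : ℝ) : inner ℂ w (T (lower s) w) =
      inner ℂ w (T (lower (s * Real.exp (-2 * t))) w) := by
    rw [← inner_apply_eq_of_apply_eq_self (hw t), ← apply_mul, diag_mul_lower, apply_mul, hw]
  have lim : Tendsto (fun s => inner ℂ w (T (lower s) w)) (𝓝 0) (𝓝 (inner ℂ w w)) := by
    simpa [lower_zero, Function.comp_def] using
      (((innerSL ℂ w).continuous.comp (hT w)).comp continuous_lower).tendsto 0
  exact tendsto_nhds_unique (tendsto_const_nhds.congr conj)
    (lim.comp (tendsto_mul_exp_neg_two_mul s))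

/-- The Mautner phenomenon for `SL(2, ℝ)`. -/
theorem apply_eq_self_of_upper (hT : IsStronglyContinuous T) {w : H}
    (hw : ∀ x, T (upper x) w = w) (g : SL(2, ℝ)) : T g w = w := by
  have hlower := apply_lower_eq_self_of_diag hT (apply_diag_eq_self_of_upper hT hw)
  induction g using Matrix.SL2.transvection_induction with
  | htransvec i j hij c =>
    fin_cases i <;> fin_cases j
    exacts [absurd rfl hij, hw c, hlower c, absurd rfl hij]
  | hmul g h hg hh => rw [apply_mul, hh, hg]

theorem IsIrreducible.eq_zero_of_forall_apply_eq_self (hirr : IsIrreducible T)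
    (hnontriv : ∃ g : SL(2, ℝ), T g ≠ 1) {w : H} (hw : ∀ g, T g w = w) : w = 0 := by
  let S : Submodule ℂ H := ⨅ g : SL(2, ℝ), LinearMap.eqLocus (T g).toLinearEquiv.toLinearMap .id
  have mem_S (v : H) : v ∈ S ↔ ∀ g, T g v = v := by simp [S, Submodule.mem_iInf]
  have isClosed_S : IsClosed (S : Set H) := by
    have hS : (S : Set H) = ⋂ g : SL(2, ℝ), {v | T g v = v} := by
      ext v
      simp [mem_S]
    rw [hS]
    exact isClosed_iInter fun g => isClosed_eq (T g).continuous continuous_id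
  rcases hirr.2 S isClosed_S (fun g v hv => ((mem_S v).1 hv g).symm ▸ hv) with h | h
  · exact (Submodule.mem_bot ℂ).1 (h ▸ (mem_S w).2 hw)
  · obtain ⟨g, hg⟩ := hnontriv
    exact absurd (LinearIsometryEquiv.ext fun v => (mem_S v).1 (h ▸ Submodule.mem_top) g) hg

theorem tendsto_inner_diag_upper_sub (hT : IsStronglyContinuous T) (s : ℝ) (x v : H) :
    Tendsto (fun t => inner ℂ x (T (upper s) (T (diag t) v)) - inner ℂ x (T (diag t) v))
      atTop (𝓝 0) := by
  have h : Tendsto (fun t => T (upper (s * Real.exp (-2 * t))) v - v) atTop (𝓝 0) := by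
    simpa [upper_zero] using ((((hT v).comp continuous_upper).tendsto 0).comp
      (tendsto_mul_exp_neg_two_mul s)).sub_const v
  have h' := h.norm.const_mul ‖x‖
  rw [norm_zero, mul_zero] at h'
  refine squeeze_zero_norm (fun t => ?_) h'
  rw [← apply_mul, upper_mul_diag, apply_mul, ← inner_sub_right, ← map_sub]
  exact (norm_inner_le_norm _ _).trans_eq (by rw [LinearIsometryEquiv.norm_map])

theorem tendsto_inner_diag_atTop [CompleteSpace H] (hT : IsStronglyContinuous T)
    (hirr : IsIrreducible T) (hnontriv : ∃ g : SL(2, ℝ), T g ≠ 1) (x v : H) :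
    Tendsto (fun t => inner ℂ x (T (diag t) v)) atTop (𝓝 0) := by
  rw [tendsto_iff_ultrafilter]
  intro U hU
  obtain ⟨w, hw⟩ := exists_weak_limit_of_norm_le U (u := fun t => T (diag t) v) (C := ‖v‖)
    (fun t => (LinearIsometryEquiv.norm_map _ _).le)
  have fixed_upper (s : ℝ) : T (upper s) w = w := by
    refine ext_inner_left ℂ fun y => ?_
    have lim := (hw (T (upper s)⁻¹ y)).sub (hw y)
    simp only [← inner_apply_right] at lim
    exact sub_eq_zero.1 (tendsto_nhds_unique lim
      ((tendsto_inner_diag_upper_sub hT s y v).mono_left hU))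
  have hw0 : w = 0 := hirr.eq_zero_of_forall_apply_eq_self hnontriv
    (apply_eq_self_of_upper hT fixed_upper)
  simpa [hw0] using hw x

/-! ### Perturbed second order differential equations -/

section ODE

variable {E : Type*} [NormedAddCommGroup E] [NormedSpace ℝ E]

theorem norm_sub_le_of_hasDerivAt_le {f f' : ℝ → E} {B B' : ℝ → ℝ} {a b : ℝ} (hab : a ≤ b)
    (hf : ∀ x ∈ Set.Icc a b, HasDerivAt f (f' x) x) (hB : ∀ x, HasDerivAt B (B' x) x)
    (hle : ∀ x ∈ Set.Icc a b, ‖f' x‖ ≤ B' x) : ‖f b - f a‖ ≤ B b - B a :=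
  image_norm_le_of_norm_deriv_right_le_deriv_boundary (f := fun x => f x - f a)
    (B := fun x => B x - B a)
    (fun x hx => ((hf x hx).sub_const _).continuousAt.continuousWithinAt)
    (fun x hx => ((hf x (Set.Ico_subset_Icc_self hx)).sub_const _).hasDerivWithinAt)
    (by simp) (fun x => (hB x).sub_const _) (fun x hx => hle x (Set.Ico_subset_Icc_self hx))
    (Set.right_mem_Icc.2 hab)

theorem eq_of_hasDerivAt_zero {f : ℝ → E} (hf : ∀ x, HasDerivAt f 0 x) (x y : ℝ) : f x = f y :=
  is_const_of_deriv_eq_zero (fun x => (hf x).differentiableAt) (fun x => (hf x).deriv) x y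

/-- `S` is the solution of `S'' = κ S` with `S 0 = 0` and `S' 0 = 1`, and `c` is its derivative. -/
structure IsFundamentalSolution (κ : ℝ) (c S : ℝ → ℝ) : Prop where
  hasDerivAt : ∀ u, HasDerivAt S (c u) u
  hasDerivAt_deriv : ∀ u, HasDerivAt c (κ * S u) u
  zero : S 0 = 0
  deriv_zero : c 0 = 1

theorem isFundamentalSolution_sin {ν : ℝ} (hν : ν ≠ 0) :
    IsFundamentalSolution (-ν ^ 2) (fun u => Real.cos (ν * u))
      (fun u => Real.sin (ν * u) / ν) where
  hasDerivAt u := (((hasDerivAt_id u).const_mul ν).sin.div_const ν).congr_deriv (by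
    simp [hν])
  hasDerivAt_deriv u := ((hasDerivAt_id u).const_mul ν).cos.congr_deriv (by
    simp only [id]
    field_simp)
  zero := by simp
  deriv_zero := by simp

theorem isFundamentalSolution_sinh {μ : ℝ} (hμ : μ ≠ 0) :
    IsFundamentalSolution (μ ^ 2) (fun u => Real.cosh (μ * u))
      (fun u => Real.sinh (μ * u) / μ) where
  hasDerivAt u := (((hasDerivAt_id u).const_mul μ).sinh.div_const μ).congr_deriv (by
    simp [hμ])
  hasDerivAt_deriv u := ((hasDerivAt_id u).const_mul μ).cosh.congr_deriv (by
    simp only [id]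
    field_simp)
  zero := by simp
  deriv_zero := by simp

theorem exists_isFundamentalSolution (κ : ℝ) : ∃ c S, IsFundamentalSolution κ c S := by
  rcases lt_trichotomy κ 0 with h | rfl | h
  · have hν : κ = -√(-κ) ^ 2 := by rw [Real.sq_sqrt (neg_nonneg.2 h.le), neg_neg]
    rw [hν]
    exact ⟨_, _, isFundamentalSolution_sin (Real.sqrt_ne_zero'.2 (neg_pos.2 h))⟩
  · exact ⟨fun _ => 1, id, hasDerivAt_id, fun u => by simpa using hasDerivAt_const u (1 : ℝ),
      rfl, rfl⟩
  · rw [← Real.sq_sqrt h.le]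
    exact ⟨_, _, isFundamentalSolution_sinh (Real.sqrt_ne_zero'.2 h)⟩

/-- The function `z`, with derivative `z₁`, solves `z'' = κ z + f` on `[a, ∞)`, where the
perturbation `f` satisfies `‖f s‖ ≤ A exp (-s)`. -/
structure IsPerturbedSolution (κ a A : ℝ) (z z₁ f : ℝ → E) : Prop where
  hasDerivAt : ∀ s, a ≤ s → HasDerivAt z (z₁ s) s
  hasDerivAt_deriv : ∀ s, a ≤ s → HasDerivAt z₁ (κ • z s + f s) s
  norm_le : ∀ s, a ≤ s → ‖f s‖ ≤ A * Real.exp (-s)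

variable {κ a A μ s t u : ℝ} {c S : ℝ → ℝ} {z z₁ f : ℝ → E}

namespace IsFundamentalSolution

theorem deriv_sq_sub (h : IsFundamentalSolution κ c S) (u : ℝ) : c u ^ 2 - κ * S u ^ 2 = 1 := by
  have hd : ∀ u, HasDerivAt (fun u => c u ^ 2 - κ * S u ^ 2) 0 u := fun u =>
    (((h.hasDerivAt_deriv u).fun_pow 2).fun_sub
      (((h.hasDerivAt u).fun_pow 2).const_mul κ)).congr_deriv (by ring)
  simpa [h.zero, h.deriv_zero] using eq_of_hasDerivAt_zero hd u 0

theorem deriv_add_mul (h : IsFundamentalSolution (μ ^ 2) c S) (u : ℝ) :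
    c u + μ * S u = Real.exp (μ * u) := by
  have hd : ∀ u, HasDerivAt (fun u => Real.exp (-(μ * u)) * (c u + μ * S u)) 0 u := fun u =>
    (((hasDerivAt_id u).const_mul μ).fun_neg.exp.fun_mul
      ((h.hasDerivAt_deriv u).fun_add ((h.hasDerivAt u).const_mul μ))).congr_deriv
        (by simp only [id]; ring)
  have hu : Real.exp (-(μ * u)) * (c u + μ * S u) = 1 := by
    simpa [h.zero, h.deriv_zero] using eq_of_hasDerivAt_zero hd u 0
  rwa [Real.exp_neg, inv_mul_eq_one₀ (Real.exp_ne_zero _), eq_comm] at hu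

theorem abs_deriv_le (h : IsFundamentalSolution κ c S) (hu : 0 ≤ u) :
    |c u| ≤ Real.exp (√κ * u) := by
  have hsq := h.deriv_sq_sub u
  rcases le_total κ 0 with hκ | hκ
  · have hS : κ * S u ^ 2 ≤ 0 := mul_nonpos_of_nonpos_of_nonneg hκ (sq_nonneg _)
    rw [Real.sqrt_eq_zero_of_nonpos hκ, zero_mul, Real.exp_zero, ← sq_le_one_iff_abs_le_one]
    linarith
  · rw [← Real.sq_sqrt hκ] at h hsq
    have hadd := h.deriv_add_mul u
    have hsub : c u - √κ * S u = Real.exp (-(√κ * u)) := by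
      rw [Real.exp_neg, ← hadd]
      exact eq_inv_of_mul_eq_one_left (by linarith)
    have hc : c u = Real.cosh (√κ * u) := by rw [Real.cosh_eq]; linarith
    have hle : Real.exp (-(√κ * u)) ≤ Real.exp (√κ * u) :=
      Real.exp_le_exp.2 (neg_le_self (by positivity))
    rw [hc, abs_of_pos (Real.cosh_pos _), Real.cosh_eq]
    linarith

theorem abs_le (h : IsFundamentalSolution κ c S) (hu : 0 ≤ u) :
    |S u| ≤ u * Real.exp (√κ * u) := by
  have hS := norm_sub_le_of_hasDerivAt_le hu (fun x _ => h.hasDerivAt x)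
    (fun x => (hasDerivAt_id x).mul_const (Real.exp (√κ * u)))
    (fun x hx => (h.abs_deriv_le hx.1).trans (by rw [one_mul]; gcongr; exact hx.2))
  simpa [h.zero] using hS

theorem sqrt_neg_mul_abs_le (h : IsFundamentalSolution κ c S) (hu : 0 ≤ u) :
    √(-κ) * |S u| ≤ Real.exp (√κ * u) := by
  have hexp : 1 ≤ Real.exp (√κ * u) := Real.one_le_exp (by positivity)
  rcases le_total κ 0 with hκ | hκ
  · refine le_trans ?_ hexp
    rw [← sq_le_one_iff₀ (by positivity), mul_pow, sq_abs, Real.sq_sqrt (neg_nonneg.2 hκ)]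
    linarith [h.deriv_sq_sub u, sq_nonneg (c u)]
  · rw [Real.sqrt_eq_zero_of_nonpos (neg_nonpos.2 hκ), zero_mul]
    positivity

theorem hasDerivAt_duhamel (h : IsFundamentalSolution κ c S) (hz : IsPerturbedSolution κ a A z z₁ f)
    (t : ℝ) (hs : a ≤ s) :
    HasDerivAt (fun s => c (t - s) • z s + S (t - s) • z₁ s) (S (t - s) • f s) s := by
  have hc := (h.hasDerivAt_deriv (t - s)).comp s ((hasDerivAt_id s).const_sub t)
  have hS := (h.hasDerivAt (t - s)).comp s ((hasDerivAt_id s).const_sub t)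
  refine ((hc.fun_smul (hz.hasDerivAt s hs)).fun_add
    (hS.fun_smul (hz.hasDerivAt_deriv s hs))).congr_deriv ?_
  simp only [Function.comp_apply]
  module

theorem norm_sub_le (h : IsFundamentalSolution κ c S) (hz : IsPerturbedSolution κ a A z z₁ f)
    (ht : a ≤ t) :
    ‖z t - (c (t - a) • z a + S (t - a) • z₁ a)‖ ≤
      A * Real.exp (-a) * ((t - a) * Real.exp (√κ * (t - a))) := by
  set P := (t - a) * Real.exp (√κ * (t - a))
  have hP : 0 ≤ P := mul_nonneg (sub_nonneg.2 ht) (Real.exp_pos _).le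
  have hS : ∀ s ∈ Set.Icc a t, |S (t - s)| ≤ P := fun s hs =>
    (h.abs_le (sub_nonneg.2 hs.2)).trans (by
      have : 0 ≤ t - s := sub_nonneg.2 hs.2
      simp only [P]
      gcongr <;> exact hs.1)
  have hbound := norm_sub_le_of_hasDerivAt_le (B := fun s => P * A * -Real.exp (-s))
    (B' := fun s => P * (A * Real.exp (-s))) ht
    (fun s hs => h.hasDerivAt_duhamel hz t hs.1)
    (fun s => ((hasDerivAt_neg s).exp.fun_neg.const_mul (P * A)).congr_deriv (by ring))
    (fun s hs => by
      rw [norm_smul]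
      exact mul_le_mul (hS s hs) (hz.norm_le s hs.1) (norm_nonneg _) hP)
  simp only [sub_self, h.zero, h.deriv_zero, one_smul, zero_smul, add_zero] at hbound
  have hAP : 0 ≤ P * (A * Real.exp (-t)) :=
    mul_nonneg hP ((norm_nonneg _).trans (hz.norm_le t ht))
  linarith

end IsFundamentalSolution

namespace IsPerturbedSolution

theorem nonneg (hz : IsPerturbedSolution κ a A z z₁ f) : 0 ≤ A :=
  nonneg_of_mul_nonneg_left ((norm_nonneg _).trans (hz.norm_le a le_rfl)) (Real.exp_pos _)

theorem hasDerivAt_exp_neg_smul (hz : IsPerturbedSolution (μ ^ 2) a A z z₁ f) (hs : a ≤ s) :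
    HasDerivAt (fun s => Real.exp (-(μ * s)) • (z₁ s + μ • z s)) (Real.exp (-(μ * s)) • f s) s := by
  refine (((hasDerivAt_id s).const_mul μ).fun_neg.exp.fun_smul ((hz.hasDerivAt_deriv s hs).fun_add
    ((hz.hasDerivAt s hs).fun_const_smul μ))).congr_deriv ?_
  simp only [id]
  module

theorem hasDerivAt_exp_smul (hz : IsPerturbedSolution κ a A z z₁ f) (μ : ℝ) (hs : a ≤ s) :
    HasDerivAt (fun s => Real.exp (μ * s) • z s) (Real.exp (μ * s) • (z₁ s + μ • z s)) s := by
  refine (((hasDerivAt_id s).const_mul μ).exp.fun_smul (hz.hasDerivAt s hs)).congr_deriv ?_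
  simp only [id]
  module

theorem norm_deriv_add_le (hz : IsPerturbedSolution (μ ^ 2) a A z z₁ f) (hμ : 0 ≤ μ)
    (hlim : Tendsto (fun s => Real.exp (-(μ * s)) • (z₁ s + μ • z s)) atTop (𝓝 0)) (hs : a ≤ s) :
    ‖z₁ s + μ • z s‖ ≤ A / (1 + μ) * Real.exp (-s) := by
  have hA := hz.nonneg
  set g : ℝ → E := fun s => Real.exp (-(μ * s)) • (z₁ s + μ • z s) with hg
  have hincr : ∀ x, s ≤ x → ‖g s‖ ≤ ‖g x‖ + A / (1 + μ) * Real.exp (-((1 + μ) * s)) := by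
    intro x hx
    have h := norm_sub_le_of_hasDerivAt_le
      (B := fun x => -(A / (1 + μ)) * Real.exp (-((1 + μ) * x)))
      (B' := fun x => A * Real.exp (-((1 + μ) * x))) hx
      (fun y hy => hz.hasDerivAt_exp_neg_smul (hs.trans hy.1))
      (fun y => (((hasDerivAt_id y).const_mul (1 + μ)).fun_neg.exp.const_mul _).congr_deriv
        (by simp only [id]; field_simp))
      (fun y hy => by
        rw [norm_smul, Real.norm_of_nonneg (Real.exp_pos _).le,
          show -((1 + μ) * y) = -(μ * y) + -y by ring, Real.exp_add, mul_left_comm]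
        gcongr
        exact hz.norm_le y (hs.trans hy.1))
    have hpos : 0 ≤ A / (1 + μ) * Real.exp (-((1 + μ) * x)) := by positivity
    linarith [norm_le_norm_add_norm_sub' (g s) (g x), norm_sub_rev (g s) (g x)]
  have hgs := ge_of_tendsto (hlim.norm.add_const _) ((eventually_ge_atTop s).mono hincr)
  rw [norm_zero, zero_add, hg, norm_smul, Real.norm_of_nonneg (Real.exp_pos _).le,
    show -((1 + μ) * s) = -(μ * s) + -s by ring, Real.exp_add, mul_left_comm] at hgs
  exact le_of_mul_le_mul_left hgs (Real.exp_pos _)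

theorem norm_le_of_tendsto (hz : IsPerturbedSolution (μ ^ 2) a A z z₁ f) (hμ : 1 ≤ μ)
    (hlim : Tendsto (fun s => Real.exp (-(μ * s)) • (z₁ s + μ • z s)) atTop (𝓝 0)) (ht : a ≤ t) :
    ‖z t‖ ≤ Real.exp (-(t - a)) * ‖z a‖ + A / 2 * (t - a) * Real.exp (-t) := by
  have hA := hz.nonneg
  have hderiv : ∀ s ∈ Set.Icc a t,
      ‖Real.exp (μ * s) • (z₁ s + μ • z s)‖ ≤ A / 2 * Real.exp ((μ - 1) * t) := fun s hs => by
    rw [norm_smul, Real.norm_of_nonneg (Real.exp_pos _).le]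
    calc Real.exp (μ * s) * ‖z₁ s + μ • z s‖
        ≤ Real.exp (μ * s) * (A / (1 + μ) * Real.exp (-s)) := by
          gcongr
          exact hz.norm_deriv_add_le (zero_le_one.trans hμ) hlim hs.1
      _ = A / (1 + μ) * Real.exp ((μ - 1) * s) := by
          rw [mul_left_comm, ← Real.exp_add]; ring_nf
      _ ≤ A / 2 * Real.exp ((μ - 1) * t) := by
          have : 0 ≤ μ - 1 := sub_nonneg.2 hμ
          gcongr
          · linarith
          · exact hs.2
  have hincr := norm_sub_le_of_hasDerivAt_le ht
    (fun s hs => hz.hasDerivAt_exp_smul μ hs.1)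
    (fun s => (hasDerivAt_id s).const_mul (A / 2 * Real.exp ((μ - 1) * t)))
    (fun s hs => by simpa using hderiv s hs)
  have hle := (norm_le_norm_add_norm_sub' (Real.exp (μ * t) • z t) (Real.exp (μ * a) • z a)).trans
    (add_le_add_right hincr _)
  rw [norm_smul, norm_smul, Real.norm_of_nonneg (Real.exp_pos _).le,
    Real.norm_of_nonneg (Real.exp_pos _).le] at hle
  refine le_of_mul_le_mul_left (hle.trans ?_) (Real.exp_pos (μ * t))
  have hexp : Real.exp (μ * a) ≤ Real.exp (μ * t) * Real.exp (-(t - a)) := by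
    rw [← Real.exp_add, Real.exp_le_exp]
    nlinarith
  have hexp' : Real.exp ((μ - 1) * t) = Real.exp (μ * t) * Real.exp (-t) := by
    rw [← Real.exp_add]; ring_nf
  simp only [id, hexp']
  linarith [mul_le_mul_of_nonneg_right hexp (norm_nonneg (z a))]

end IsPerturbedSolution

end ODE

/-! ### The coefficients of the radial equation -/

theorem exp_neg_two_le : Real.exp (-2) ≤ 1 / 7 := by
  have he : (7 : ℝ) ≤ Real.exp 2 := calc
    (7 : ℝ) ≤ 2.7 ^ 2 := by norm_num
    _ ≤ Real.exp 1 ^ 2 := by gcongr; linarith [Real.exp_one_gt_d9]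
    _ = Real.exp 2 := by rw [← Real.exp_nat_mul]; norm_num
  rw [Real.exp_neg, one_div]
  gcongr

theorem exp_neg_four_le : Real.exp (-4) ≤ 1 / 49 := calc
  Real.exp (-4) = Real.exp (-2) ^ 2 := by rw [← Real.exp_nat_mul]; norm_num
  _ ≤ (1 / 7) ^ 2 := by gcongr; exact exp_neg_two_le
  _ = 1 / 49 := by norm_num

theorem C1_mul : C1 * (1 - Real.exp (-4)) = 1 :=
  inv_mul_cancel₀ (by linarith [exp_neg_four_le])

theorem one_le_C1 : 1 ≤ C1 := by
  rw [C1, one_le_inv₀ (by linarith [exp_neg_four_le])]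
  linarith [Real.exp_pos (-4)]

theorem C1_pos : 0 < C1 := one_pos.trans_le one_le_C1

theorem C1_le : C1 ≤ 49 / 48 := by
  rw [C1]
  exact inv_le_of_inv_le₀ (by norm_num) (by linarith [exp_neg_four_le])

theorem C2_eq : C2 = 2 * C1 * (1 + 2 * C1 * Real.exp (-2) + 2 * C1 * Real.exp (-4)) := by
  have : 1 - (Real.exp 4)⁻¹ ≠ 0 := by
    rw [← Real.exp_neg]; linarith [exp_neg_four_le]
  rw [C2, C1, Real.exp_neg 2, Real.exp_neg 4]
  field_simp

theorem C2_pos : 0 < C2 := by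
  have := C1_pos
  rw [C2_eq]
  positivity

theorem C2_le : C2 ≤ 3 := by
  have hC1 := C1_pos
  have hC1' := C1_le
  have he := exp_neg_two_le
  have he' := exp_neg_four_le
  rw [C2_eq]
  calc 2 * C1 * (1 + 2 * C1 * Real.exp (-2) + 2 * C1 * Real.exp (-4))
      ≤ 2 * (49 / 48) * (1 + 2 * (49 / 48) * (1 / 7) + 2 * (49 / 48) * (1 / 49)) := by gcongr
    _ ≤ 3 := by norm_num

/-- The integrating factor `w` of the radial equation: it solves `w' = coth (2t) w`. -/
noncomputable def weight (t : ℝ) : ℝ := √(2 * Real.sinh (2 * t))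

/-- `coth (2t)`, half of the first order coefficient of the radial equation. -/
noncomputable def radialCoth (t : ℝ) : ℝ := Real.cosh (2 * t) / Real.sinh (2 * t)

/-- The decaying part of the potential of the radial equation in Liouville normal form
`z'' = (1 + 4 lam + potential n m t) z`, where `z = weight • y`. -/
noncomputable def potential (n m t : ℝ) : ℝ :=
  (n ^ 2 + m ^ 2 - 1 - 2 * m * n * Real.cosh (2 * t)) / Real.sinh (2 * t) ^ 2

section Estimates

variable {t : ℝ}

theorem sinh_two_mul_pos (ht : 0 < t) : 0 < Real.sinh (2 * t) :=
  Real.sinh_pos_iff.2 (by linarith)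

theorem two_mul_sinh_two_mul (t : ℝ) :
    2 * Real.sinh (2 * t) = Real.exp t ^ 2 * (1 - Real.exp (-4 * t)) := by
  rw [Real.sinh_eq, mul_sub, mul_one, ← Real.exp_nat_mul, ← Real.exp_add]
  ring_nf

theorem weight_pos (ht : 0 < t) : 0 < weight t :=
  Real.sqrt_pos.2 (by linarith [sinh_two_mul_pos ht])

theorem weight_sq (ht : 0 < t) : weight t ^ 2 = 2 * Real.sinh (2 * t) :=
  Real.sq_sqrt (by linarith [sinh_two_mul_pos ht])

theorem weight_le_exp (t : ℝ) : weight t ≤ Real.exp t := by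
  refine Real.sqrt_le_iff.2 ⟨(Real.exp_pos t).le, ?_⟩
  rw [two_mul_sinh_two_mul]
  exact mul_le_of_le_one_right (sq_nonneg _) (by linarith [Real.exp_pos (-4 * t)])

theorem exp_sq_le (ht : 1 ≤ t) : Real.exp t ^ 2 ≤ C1 * (2 * Real.sinh (2 * t)) := by
  have hexp : Real.exp (-4 * t) ≤ Real.exp (-4) := Real.exp_le_exp.2 (by linarith)
  have hC1 := C1_pos
  rw [two_mul_sinh_two_mul]
  calc Real.exp t ^ 2 = Real.exp t ^ 2 * (C1 * (1 - Real.exp (-4))) := by rw [C1_mul, mul_one]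
    _ ≤ Real.exp t ^ 2 * (C1 * (1 - Real.exp (-4 * t))) := by gcongr
    _ = C1 * (Real.exp t ^ 2 * (1 - Real.exp (-4 * t))) := mul_left_comm _ _ _

theorem exp_le_C1_mul_weight (ht : 1 ≤ t) : Real.exp t ≤ C1 * weight t := by
  have ht₀ := one_pos.trans_le ht
  have hC1 := C1_pos
  refine le_of_sq_le_sq ?_ (by have := weight_pos ht₀; positivity)
  calc Real.exp t ^ 2 ≤ C1 * (2 * Real.sinh (2 * t)) := exp_sq_le ht
    _ ≤ C1 ^ 2 * (2 * Real.sinh (2 * t)) := by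
        have := sinh_two_mul_pos ht₀
        gcongr
        exact le_self_pow₀ one_le_C1 two_ne_zero
    _ = (C1 * weight t) ^ 2 := by rw [mul_pow, weight_sq ht₀]

theorem weight_one_mul_exp_le (ht : 1 ≤ t) :
    weight 1 * Real.exp t ≤ Real.exp 1 * weight t := by
  have ht₀ := one_pos.trans_le ht
  have hexp : Real.exp (-4 * t) ≤ Real.exp (-4 * 1) := Real.exp_le_exp.2 (by linarith)
  refine le_of_sq_le_sq ?_ (by have := weight_pos ht₀; positivity)
  rw [mul_pow, mul_pow, weight_sq ht₀, weight_sq one_pos, two_mul_sinh_two_mul,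
    two_mul_sinh_two_mul, mul_assoc, mul_comm (1 - _)]
  gcongr

theorem radialCoth_pos (ht : 0 < t) : 0 < radialCoth t :=
  div_pos (Real.cosh_pos _) (sinh_two_mul_pos ht)

theorem radialCoth_le_two (ht : 1 ≤ t) : radialCoth t ≤ 2 := by
  rw [radialCoth, div_le_iff₀ (sinh_two_mul_pos (by linarith)), Real.sinh_eq, Real.cosh_eq]
  have h₁ : Real.exp (-(2 * t)) ≤ 1 := Real.exp_le_one_iff.2 (by linarith)
  have h₂ := Real.add_one_le_exp (2 * t)
  linarith

theorem radialCoth_sq (ht : 0 < t) : radialCoth t ^ 2 = 1 + 1 / Real.sinh (2 * t) ^ 2 := by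
  have := sinh_two_mul_pos ht
  rw [radialCoth]
  field_simp
  linarith [Real.cosh_sq_sub_sinh_sq (2 * t)]

theorem radialCoth_eq (ht : 0 < t) :
    radialCoth t = 1 + Real.exp (-2 * t) * (1 / Real.sinh (2 * t)) := by
  have := sinh_two_mul_pos ht
  rw [radialCoth, ← Real.cosh_add_sinh (-2 * t), neg_mul, Real.cosh_neg, Real.sinh_neg]
  field_simp
  ring

theorem hasDerivAt_weight (ht : 0 < t) : HasDerivAt weight (radialCoth t * weight t) t := by
  have hs := sinh_two_mul_pos ht
  have hw := weight_pos ht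
  refine ((((hasDerivAt_id t).const_mul 2).sinh.const_mul 2).sqrt
    (mul_pos two_pos hs).ne').congr_deriv ?_
  change _ / (2 * weight t) = _
  rw [radialCoth]
  simp only [id]
  field_simp
  rw [weight_sq ht]

theorem hasDerivAt_radialCoth (ht : 0 < t) :
    HasDerivAt radialCoth (2 * (1 - radialCoth t ^ 2)) t := by
  have hs := sinh_two_mul_pos ht
  refine (((hasDerivAt_id t).const_mul 2).cosh.div ((hasDerivAt_id t).const_mul 2).sinh
    hs.ne').congr_deriv ?_
  rw [radialCoth]
  simp only [id]
  field_simp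

theorem one_div_sinh_two_mul_le (ht : 1 ≤ t) :
    1 / Real.sinh (2 * t) ≤ 2 * C1 * Real.exp (-2 * t) := by
  have hexp : Real.exp t ^ 2 * Real.exp (-2 * t) = 1 := by
    rw [← Real.exp_nat_mul, ← Real.exp_add]; simp
  rw [div_le_iff₀ (sinh_two_mul_pos (by linarith))]
  nlinarith [Real.exp_pos (-2 * t), exp_sq_le ht]

theorem one_add_cosh_div_le (ht : 1 ≤ t) :
    (1 + Real.cosh (2 * t)) / Real.sinh (2 * t) ^ 2 ≤ C2 * Real.exp (-2 * t) := by
  have ht₀ := one_pos.trans_le ht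
  have := sinh_two_mul_pos ht₀
  have hC1 := C1_pos
  have hinv := one_div_sinh_two_mul_le ht
  have hexp : Real.exp (-2 * t) ≤ Real.exp (-2) := Real.exp_le_exp.2 (by linarith)
  have hinv' : 1 / Real.sinh (2 * t) ≤ 2 * C1 * Real.exp (-2) := hinv.trans (by gcongr)
  have hcoth : radialCoth t ≤ 1 + 2 * C1 * Real.exp (-4) := calc
    radialCoth t ≤ 1 + Real.exp (-2) * (2 * C1 * Real.exp (-2)) := by
      rw [radialCoth_eq ht₀]; gcongr
    _ = 1 + 2 * C1 * Real.exp (-4) := by rw [mul_left_comm, ← Real.exp_add]; norm_num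
  have hcoth₀ := radialCoth_pos ht₀
  calc (1 + Real.cosh (2 * t)) / Real.sinh (2 * t) ^ 2
      = 1 / Real.sinh (2 * t) * (1 / Real.sinh (2 * t) + radialCoth t) := by
        rw [radialCoth]; field_simp
    _ ≤ 2 * C1 * Real.exp (-2 * t) *
          (2 * C1 * Real.exp (-2) + (1 + 2 * C1 * Real.exp (-4))) := by gcongr
    _ = C2 * Real.exp (-2 * t) := by rw [C2_eq]; ring

theorem abs_potential_le {n m K : ℝ} (ht : 1 ≤ t) (hK : n ^ 2 + m ^ 2 ≤ K)
    (hK' : 1 - (n ^ 2 + m ^ 2) ≤ K) : |potential n m t| ≤ K * C2 * Real.exp (-2 * t) := by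
  have hcosh := Real.cosh_pos (2 * t)
  have hK₀ : 0 ≤ K := le_trans (by positivity) hK
  have hnum : |n ^ 2 + m ^ 2 - 1 - 2 * m * n * Real.cosh (2 * t)| ≤
      K * (1 + Real.cosh (2 * t)) := by
    rw [abs_le]
    constructor <;> nlinarith [sq_nonneg (n - m), sq_nonneg (n + m)]
  rw [potential, abs_div, abs_sq]
  calc |n ^ 2 + m ^ 2 - 1 - 2 * m * n * Real.cosh (2 * t)| / Real.sinh (2 * t) ^ 2
      ≤ K * (1 + Real.cosh (2 * t)) / Real.sinh (2 * t) ^ 2 := by gcongr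
    _ = K * ((1 + Real.cosh (2 * t)) / Real.sinh (2 * t) ^ 2) := mul_div_assoc _ _ _
    _ ≤ K * (C2 * Real.exp (-2 * t)) := by gcongr; exact one_add_cosh_div_le ht
    _ = K * C2 * Real.exp (-2 * t) := (mul_assoc _ _ _).symm

end Estimates

/-! ### Solutions of the radial equation -/

section Radial

variable {E : Type*} [NormedAddCommGroup E] [NormedSpace ℝ E] {n m lam t : ℝ} {y y₁ y₂ : ℝ → E}

/-- The function `y`, with derivatives `y₁` and `y₂`, is bounded by one and solves the radial
equation `y'' + 2 coth (2t) y' = (4 lam + (n² + m² - 2mn cosh (2t)) / sinh² (2t)) y`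
for `t > 0`. -/
structure IsRadialSolution (n m lam : ℝ) (y y₁ y₂ : ℝ → E) : Prop where
  hasDerivAt : ∀ t, 0 < t → HasDerivAt y (y₁ t) t
  hasDerivAt_deriv : ∀ t, 0 < t → HasDerivAt y₁ (y₂ t) t
  ode : ∀ t, 0 < t → y₂ t = (4 * lam + (n ^ 2 + m ^ 2 - 2 * m * n * Real.cosh (2 * t)) /
    Real.sinh (2 * t) ^ 2) • y t - (2 * radialCoth t) • y₁ t
  norm_le : ∀ t, ‖y t‖ ≤ 1

theorem norm_potential_smul_le {x : E} (hx : ‖x‖ ≤ 1) {K : ℝ} (ht : 1 ≤ t)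
    (hK : n ^ 2 + m ^ 2 ≤ K) (hK' : 1 - (n ^ 2 + m ^ 2) ≤ K) :
    ‖potential n m t • weight t • x‖ ≤ K * C2 * Real.exp (-t) := by
  have hpot := abs_potential_le ht hK hK'
  have hw : ‖weight t • x‖ ≤ Real.exp t := by
    rw [norm_smul, Real.norm_of_nonneg (weight_pos (by linarith)).le]
    exact (mul_le_of_le_one_right (weight_pos (by linarith)).le hx).trans (weight_le_exp t)
  calc ‖potential n m t • weight t • x‖ = |potential n m t| * ‖weight t • x‖ := norm_smul _ _
    _ ≤ K * C2 * Real.exp (-2 * t) * Real.exp t :=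
        mul_le_mul hpot hw (norm_nonneg _) ((abs_nonneg _).trans hpot)
    _ = K * C2 * Real.exp (-t) := by rw [mul_assoc, ← Real.exp_add]; ring_nf

theorem norm_le_of_norm_weight_smul_le {x : E} {X Y : ℝ} (ht : 1 ≤ t) (hX : 0 ≤ X) (hY : 0 ≤ Y)
    (h : ‖weight t • x‖ ≤ weight 1 * X + Y) :
    ‖x‖ ≤ Real.exp (-t) * (Real.exp 1 * X + C1 * Y) := by
  have hw := weight_pos (one_pos.trans_le ht)
  rw [Real.exp_neg, le_inv_mul_iff₀ (Real.exp_pos t)]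
  refine le_of_mul_le_mul_left ?_ hw
  calc weight t * (Real.exp t * ‖x‖) = Real.exp t * ‖weight t • x‖ := by
        rw [norm_smul, Real.norm_of_nonneg hw.le, mul_left_comm]
    _ ≤ Real.exp t * (weight 1 * X + Y) := by gcongr
    _ = weight 1 * Real.exp t * X + Real.exp t * Y := by ring
    _ ≤ Real.exp 1 * weight t * X + C1 * weight t * Y :=
        add_le_add (mul_le_mul_of_nonneg_right (weight_one_mul_exp_le ht) hX)
          (mul_le_mul_of_nonneg_right (exp_le_C1_mul_weight ht) hY)
    _ = weight t * (Real.exp 1 * X + C1 * Y) := by ring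

theorem norm_add_radialCoth_smul_le (ht : 1 ≤ t) (x₁ x : E) :
    ‖x₁ + radialCoth t • x‖ ≤ ‖x₁‖ + 2 * ‖x‖ := by
  refine (norm_add_le _ _).trans ?_
  rw [norm_smul, Real.norm_of_nonneg (radialCoth_pos (one_pos.trans_le ht)).le]
  gcongr
  exact radialCoth_le_two ht

theorem tendsto_exp_neg_smul_weight_smul (hy : Tendsto y atTop (𝓝 0))
    (hy₁ : Tendsto y₁ atTop (𝓝 0)) {μ : ℝ} (hμ : 1 ≤ μ) :
    Tendsto (fun s => Real.exp (-(μ * s)) • (weight s • (y₁ s + radialCoth s • y s) +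
      μ • weight s • y s)) atTop (𝓝 0) := by
  have hlim : Tendsto (fun s => ‖y₁ s‖ + (2 + μ) * ‖y s‖) atTop (𝓝 0) := by
    simpa using hy₁.norm.add (hy.norm.const_mul (2 + μ))
  refine squeeze_zero_norm' ?_ hlim
  filter_upwards [eventually_ge_atTop 1] with s hs
  have hw := weight_pos (one_pos.trans_le hs)
  have hexp : Real.exp (-(μ * s)) * weight s ≤ 1 := calc
    Real.exp (-(μ * s)) * weight s ≤ Real.exp (-(μ * s)) * Real.exp s := by
      gcongr
      exact weight_le_exp s
    _ = Real.exp (-(μ * s) + s) := (Real.exp_add _ _).symm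
    _ ≤ 1 := Real.exp_le_one_iff.2 (by nlinarith)
  calc ‖Real.exp (-(μ * s)) • (weight s • (y₁ s + radialCoth s • y s) + μ • weight s • y s)‖
      = Real.exp (-(μ * s)) * weight s * ‖y₁ s + radialCoth s • y s + μ • y s‖ := by
        rw [smul_comm μ, ← smul_add, smul_smul, norm_smul, Real.norm_of_nonneg (by positivity)]
    _ ≤ 1 * (‖y₁ s‖ + 2 * ‖y s‖ + μ * ‖y s‖) := by
        gcongr
        refine (norm_add_le _ _).trans ?_
        rw [norm_smul, Real.norm_of_nonneg (by linarith)]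
        gcongr
        exact norm_add_radialCoth_smul_le hs _ _
    _ = ‖y₁ s‖ + (2 + μ) * ‖y s‖ := by ring

namespace IsRadialSolution

theorem hasDerivAt_weight_smul (h : IsRadialSolution n m lam y y₁ y₂) (ht : 0 < t) :
    HasDerivAt (fun t => weight t • y t) (weight t • (y₁ t + radialCoth t • y t)) t := by
  refine ((hasDerivAt_weight ht).fun_smul (h.hasDerivAt t ht)).congr_deriv ?_
  module

theorem hasDerivAt_weight_smul_deriv (h : IsRadialSolution n m lam y y₁ y₂) (ht : 0 < t) :
    HasDerivAt (fun t => weight t • (y₁ t + radialCoth t • y t))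
      ((1 + 4 * lam) • weight t • y t + potential n m t • weight t • y t) t := by
  refine ((hasDerivAt_weight ht).fun_smul ((h.hasDerivAt_deriv t ht).fun_add
    ((hasDerivAt_radialCoth ht).fun_smul (h.hasDerivAt t ht)))).congr_deriv ?_
  have hpot : potential n m t = (n ^ 2 + m ^ 2 - 2 * m * n * Real.cosh (2 * t)) /
      Real.sinh (2 * t) ^ 2 - (radialCoth t ^ 2 - 1) := by
    rw [potential, radialCoth_sq ht]
    ring
  rw [h.ode t ht, hpot]
  module

theorem isPerturbedSolution (h : IsRadialSolution n m lam y y₁ y₂) {K : ℝ}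
    (hK : n ^ 2 + m ^ 2 ≤ K) (hK' : 1 - (n ^ 2 + m ^ 2) ≤ K) :
    IsPerturbedSolution (1 + 4 * lam) 1 (K * C2) (fun s => weight s • y s)
      (fun s => weight s • (y₁ s + radialCoth s • y s))
      (fun s => potential n m s • weight s • y s) where
  hasDerivAt s hs := h.hasDerivAt_weight_smul (by linarith)
  hasDerivAt_deriv s hs := h.hasDerivAt_weight_smul_deriv (by linarith)
  norm_le s hs := norm_potential_smul_le (h.norm_le s) hs hK hK'

theorem norm_weight_smul_le (h : IsRadialSolution n m lam y y₁ y₂) (ht : 0 < t) :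
    ‖weight t • y t‖ ≤ weight t := by
  rw [norm_smul, Real.norm_of_nonneg (weight_pos ht).le]
  exact mul_le_of_le_one_right (weight_pos ht).le (h.norm_le t)

theorem norm_fundamental_le (h : IsRadialSolution n m lam y y₁ y₂)
    (hy : ‖y₁ 1‖ ≤ 1 + m ^ 2 / 2 + √(-(1 + 4 * lam))) {c S : ℝ → ℝ}
    (hS : IsFundamentalSolution (1 + 4 * lam) c S) {u : ℝ} (hu : 0 ≤ u) :
    ‖c u • weight 1 • y 1 + S u • weight 1 • (y₁ 1 + radialCoth 1 • y 1)‖ ≤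
      weight 1 * ((2 + (3 + m ^ 2 / 2) * u) * Real.exp (√(1 + 4 * lam) * u)) := by
  set κ := 1 + 4 * lam
  have hw := weight_pos one_pos
  have hy' : ‖y₁ 1 + radialCoth 1 • y 1‖ ≤ 3 + m ^ 2 / 2 + √(-κ) := by
    linarith [norm_add_radialCoth_smul_le le_rfl (y₁ 1) (y 1), h.norm_le 1]
  calc ‖c u • weight 1 • y 1 + S u • weight 1 • (y₁ 1 + radialCoth 1 • y 1)‖
      ≤ |c u| * ‖weight 1 • y 1‖ + |S u| * (weight 1 * ‖y₁ 1 + radialCoth 1 • y 1‖) := by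
        refine (norm_add_le _ _).trans_eq ?_
        rw [norm_smul (c u), norm_smul (S u), norm_smul _ (y₁ 1 + _),
          Real.norm_of_nonneg hw.le, Real.norm_eq_abs, Real.norm_eq_abs]
    _ ≤ |c u| * weight 1 + |S u| * (weight 1 * (3 + m ^ 2 / 2 + √(-κ))) := by
        gcongr
        exact h.norm_weight_smul_le one_pos
    _ = weight 1 * (|c u| + (3 + m ^ 2 / 2) * |S u| + √(-κ) * |S u|) := by ring
    _ ≤ weight 1 * (Real.exp (√κ * u) + (3 + m ^ 2 / 2) * (u * Real.exp (√κ * u)) +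
          Real.exp (√κ * u)) := by
        gcongr
        · exact hS.abs_deriv_le hu
        · exact hS.abs_le hu
        · exact hS.sqrt_neg_mul_abs_le hu
    _ = weight 1 * ((2 + (3 + m ^ 2 / 2) * u) * Real.exp (√κ * u)) := by ring

theorem norm_le_of_norm_deriv_le (h : IsRadialSolution n m lam y y₁ y₂)
    (hy : ‖y₁ 1‖ ≤ 1 + m ^ 2 / 2 + √(-(1 + 4 * lam))) (ht : 1 ≤ t) :
    ‖y t‖ ≤ (Real.exp 1 * (3 + m ^ 2 / 2) + C1 * C2 * (n ^ 2 + m ^ 2 + 1) * Real.exp (-1)) *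
        (t * Real.exp ((-1 + √(1 + 4 * lam)) * t)) := by
  set N := n ^ 2 + m ^ 2
  have hN : 0 ≤ N := by positivity
  set κ := 1 + 4 * lam
  have ht' : 0 ≤ t - 1 := sub_nonneg.2 ht
  have hC1 := C1_pos
  have hC2 := C2_pos
  obtain ⟨c, S, hS⟩ := exists_isFundamentalSolution κ
  have hduhamel := hS.norm_sub_le
    (h.isPerturbedSolution (K := N + 1) (by linarith) (by linarith)) ht
  have hz := (norm_le_norm_add_norm_sub' _ _).trans
    (add_le_add (h.norm_fundamental_le hy hS ht') hduhamel)
  have hexp : Real.exp (√κ * (t - 1)) ≤ Real.exp (√κ * t) := by gcongr; linarith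
  have hlin : 2 + (3 + m ^ 2 / 2) * (t - 1) ≤ (3 + m ^ 2 / 2) * t := by
    linarith [sq_nonneg m]
  calc ‖y t‖ ≤ Real.exp (-t) *
        (Real.exp 1 * ((2 + (3 + m ^ 2 / 2) * (t - 1)) * Real.exp (√κ * (t - 1))) +
          C1 * ((N + 1) * C2 * Real.exp (-1) * ((t - 1) * Real.exp (√κ * (t - 1))))) :=
        norm_le_of_norm_weight_smul_le ht (by positivity) (by positivity) hz
    _ ≤ Real.exp (-t) * (Real.exp 1 * ((3 + m ^ 2 / 2) * t * Real.exp (√κ * t)) +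
          C1 * ((N + 1) * C2 * Real.exp (-1) * (t * Real.exp (√κ * t)))) := by
        gcongr
        linarith
    _ = (Real.exp 1 * (3 + m ^ 2 / 2) + C1 * C2 * (N + 1) * Real.exp (-1)) *
          (t * Real.exp ((-1 + √κ) * t)) := by
        rw [add_mul (-1), Real.exp_add, neg_one_mul]
        ring

theorem norm_le_of_tendsto (h : IsRadialSolution n m lam y y₁ y₂) (hlam : 0 ≤ lam)
    (hm : 1 ≤ m ^ 2) (hy : Tendsto y atTop (𝓝 0)) (hy₁ : Tendsto y₁ atTop (𝓝 0)) (ht : 1 ≤ t) :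
    ‖y t‖ ≤ (Real.exp 2 + C1 * C2 * (n ^ 2 + m ^ 2) / 2 * (t - 1)) * Real.exp (-2 * t) := by
  have hn := sq_nonneg n
  have hμ : 1 ≤ √(1 + 4 * lam) := Real.one_le_sqrt.2 (by linarith)
  have hz := h.isPerturbedSolution (K := n ^ 2 + m ^ 2) le_rfl (by linarith)
  rw [← Real.sq_sqrt (by linarith : 0 ≤ 1 + 4 * lam)] at hz
  have := sub_nonneg.2 ht
  have hA := hz.nonneg
  have hzt : ‖weight t • y t‖ ≤ weight 1 * Real.exp (-(t - 1)) +
      (n ^ 2 + m ^ 2) * C2 / 2 * (t - 1) * Real.exp (-t) := by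
    refine (hz.norm_le_of_tendsto hμ (tendsto_exp_neg_smul_weight_smul hy hy₁ hμ) ht).trans ?_
    rw [mul_comm (weight 1)]
    gcongr
    exact h.norm_weight_smul_le one_pos
  refine (norm_le_of_norm_weight_smul_le ht (by positivity) (by positivity) hzt).trans_eq ?_
  rw [show -(t - 1) = 1 + -t by ring, show (2 : ℝ) = 1 + 1 by norm_num,
    show -(1 + 1) * t = -t + -t by ring, Real.exp_add, Real.exp_add, Real.exp_add]
  ring

end IsRadialSolution

end Radial

/-! ### Matrix coefficients along the diagonal subgroup -/

section Coefficients

variable {n m : ℤ} {lam : ℝ} {v w : H}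

theorem norm_inner_apply_le (hw : ‖w‖ ≤ 1) (g : SL(2, ℝ)) (u : H) : ‖inner ℂ w (T g u)‖ ≤ ‖u‖ :=
  calc ‖inner ℂ w (T g u)‖ ≤ ‖w‖ * ‖T g u‖ := norm_inner_le_norm _ _
    _ ≤ ‖u‖ := by
        rw [LinearIsometryEquiv.norm_map]
        exact mul_le_of_le_one_left (norm_nonneg u) hw

theorem IsCkVector.hasDerivAt_inner_diag (hv : IsCkVector T 1 v) (w : H) (t : ℝ) :
    HasDerivAt (fun t => inner ℂ w (T (diag t) v))
      (inner ℂ w (T (diag t) (Ratner.lieDeriv T diag v))) t :=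
  ((innerSL ℂ w).restrictScalars ℝ).hasFDerivAt.comp_hasDerivAt t
    (hv.hasDerivAt isOneParam_diag t)

namespace IsCasimirParameter

theorem isRadialSolution_inner_diag (hlam : IsCasimirParameter T lam) (hv : v ∈ kTypeSpace T m)
    (hv' : IsCkVector T 2 v) (hv₁ : ‖v‖ ≤ 1) (hw : w ∈ kTypeSpace T n) (hw' : IsCkVector T 1 w)
    (hw₁ : ‖w‖ ≤ 1) :
    IsRadialSolution n m lam (fun t => inner ℂ w (T (diag t) v))
      (fun t => inner ℂ w (T (diag t) (lieDeriv T diag v)))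
      (fun t => inner ℂ w (T (diag t) (lieDeriv T diag (lieDeriv T diag v)))) where
  hasDerivAt t _ := (hv'.mono one_le_two).hasDerivAt_inner_diag w t
  hasDerivAt_deriv t _ := (hv'.lieDeriv isOneParam_diag).hasDerivAt_inner_diag w t
  ode t ht := by
    rw [inner_diag_lieDeriv_lieDeriv hlam hv hv' hw hw' ht.ne', Complex.real_smul,
      Complex.real_smul, radialCoth]
  norm_le t := (norm_inner_apply_le hw₁ _ _).trans hv₁

theorem norm_lieDeriv_diag_le (hlam : IsCasimirParameter T lam) (hv : v ∈ kTypeSpace T m)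
    (hv' : IsCkVector T 2 v) (hv₁ : ‖v‖ ≤ 1) :
    ‖lieDeriv T diag v‖ ≤ 1 + (m : ℝ) ^ 2 / 2 + √(-(1 + 4 * lam)) := by
  set s := √(-(1 + 4 * lam))
  have hs : -(1 + 4 * lam) ≤ s ^ 2 := Real.sq_sqrt' ▸ le_max_left _ _
  have hs₀ : 0 ≤ s := Real.sqrt_nonneg _
  refine le_of_sq_le_sq ?_ (by positivity)
  calc ‖lieDeriv T diag v‖ ^ 2 ≤ ((m : ℝ) ^ 2 - 4 * lam) * ‖v‖ ^ 2 :=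
        hlam.norm_lieDeriv_diag_sq_le hv hv'
    _ ≤ ((m : ℝ) ^ 2 + 1 + s ^ 2) * 1 := by
        gcongr
        · linarith
        · exact pow_le_one₀ (norm_nonneg v) hv₁
    _ ≤ (1 + (m : ℝ) ^ 2 / 2 + s) ^ 2 := by nlinarith [sq_nonneg (m : ℝ)]

theorem lieDeriv_diag_eq_zero (hlam : IsCasimirParameter T lam) (h : 0 ≤ lam)
    (hv : v ∈ kTypeSpace T 0) (hv' : IsCkVector T 2 v) : lieDeriv T diag v = 0 := by
  have hle : ‖lieDeriv T diag v‖ ^ 2 ≤ 0 :=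
    (hlam.norm_lieDeriv_diag_sq_le hv hv').trans
      (mul_nonpos_of_nonpos_of_nonneg (by simpa using h) (sq_nonneg _))
  exact norm_eq_zero.1 (sq_eq_zero_iff.1 (hle.antisymm (sq_nonneg _)))

end IsCasimirParameter

theorem IsCkVector.eq_zero_of_lieDeriv_diag_eq_zero [CompleteSpace H] (hT : IsStronglyContinuous T)
    (hirr : IsIrreducible T) (hnontriv : ∃ g : SL(2, ℝ), T g ≠ 1) (hv : IsCkVector T 1 v)
    (h : Ratner.lieDeriv T diag v = 0) : v = 0 := by
  have hconst (t : ℝ) : inner ℂ v (T (diag t) v) = inner ℂ v (T (diag 0) v) :=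
    eq_of_hasDerivAt_zero (f := fun t => inner ℂ v (T (diag t) v))
      (fun t => by simpa [h] using hv.hasDerivAt_inner_diag v t) t 0
  have hlim := (tendsto_inner_diag_atTop hT hirr hnontriv v v).congr hconst
  have hzero := tendsto_nhds_unique tendsto_const_nhds hlim
  rw [isOneParam_diag.zero, map_one] at hzero
  exact inner_self_eq_zero.1 hzero

theorem IsCasimirParameter.one_le_kType_sq [CompleteSpace H] (hlam : IsCasimirParameter T lam)
    (hT : IsStronglyContinuous T) (hirr : IsIrreducible T) (hnontriv : ∃ g : SL(2, ℝ), T g ≠ 1)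
    (h : 0 ≤ lam) (hv : v ∈ kTypeSpace T m) (hv' : IsCkVector T 2 v) (hv₀ : v ≠ 0) :
    1 ≤ (m : ℝ) ^ 2 := by
  have hm : m ≠ 0 := by
    rintro rfl
    exact hv₀ ((hv'.mono one_le_two).eq_zero_of_lieDeriv_diag_eq_zero hT hirr hnontriv
      (hlam.lieDeriv_diag_eq_zero h hv hv'))
  exact_mod_cast (one_le_sq_iff_one_le_abs m).2 (Int.one_le_abs hm)

end Coefficients

/-! ### Comparison with the explicit constants -/

section Constants

variable {n m : ℤ} {lam t : ℝ} {φ : ℤ → H}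

theorem C1_mul_C2_mul_exp_neg_one_le : C1 * C2 * Real.exp (-1) ≤ 5 / 4 := by
  have hexp : Real.exp (-1) ≤ 2 / 5 := by
    rw [Real.exp_neg]
    exact inv_le_of_inv_le₀ (by norm_num) (by linarith [Real.exp_one_gt_d9])
  calc C1 * C2 * Real.exp (-1) ≤ 49 / 48 * 3 * (2 / 5) := by
        have := C2_pos
        gcongr
        exacts [C1_le, C2_le]
    _ ≤ 5 / 4 := by norm_num

theorem C1_mul_C2_le : C1 * C2 ≤ C1 + C2 := by
  nlinarith [one_le_C1, C1_le, C2_le]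

theorem C1_mul_C2_add_le_Kbar (h : lam < 0) :
    C1 * C2 * Real.exp (-1) + Real.exp 1 / 2 ≤ Kbar lam := by
  have hC1 := C1_pos
  have hC2 := C2_pos
  have hle : C1 * C2 * Real.exp (-1) ≤ 2 * C2 / Real.exp 1 := by
    rw [div_eq_mul_inv, ← Real.exp_neg]
    gcongr
    linarith [C1_le]
  have hpos : 0 ≤ 4 * C1 / (9 * Real.exp 3) := by positivity
  rw [Kbar, if_pos h]
  linarith [Real.exp_pos 1]

theorem C1_mul_C2_add_le_Ktilde (h : lam < 0) :
    C1 * C2 * Real.exp (-1) + 3 * Real.exp 1 ≤ Ktilde lam := by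
  have hC1 := C1_pos
  have hle := C1_mul_C2_mul_exp_neg_one_le
  have he : 2.7 < Real.exp 1 := by linarith [Real.exp_one_gt_d9]
  rw [Ktilde, if_pos h]
  split_ifs
  · have hsqrt : (1.4 : ℝ) ≤ √2 := Real.le_sqrt_of_sq_le (by norm_num)
    have hpos : 0 ≤ (32 + √2) * C1 ^ 2 / (3 * Real.exp 3) := by positivity
    nlinarith
  · have hpos : 0 ≤ 4 * C1 / (9 * Real.exp 3) := by positivity
    have hexp : Real.exp 1 ≤ Real.exp 2 := Real.exp_le_exp.2 one_le_two
    linarith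

theorem Kbar_of_nonneg (h : 0 ≤ lam) : Kbar lam = (C1 + C2) / 2 := if_neg h.not_gt

theorem Ktilde_of_nonneg (h : 0 ≤ lam) : Ktilde lam = Real.exp 2 := by
  rw [Ktilde, if_neg (by linarith), if_neg h.not_gt]

theorem b_of_neg (h : lam < 0) (t : ℝ) :
    b lam t = t * Real.exp ((-1 + √(1 + 4 * lam)) * t) := by
  rw [b, if_pos h, ite_eq_right_iff]
  intro h'
  rw [Real.sqrt_eq_zero_of_nonpos (by linarith), add_zero, neg_one_mul]

theorem b_of_nonneg (h : 0 ≤ lam) (t : ℝ) : b lam t = t * Real.exp (-2 * t) := by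
  rw [b, if_neg (by linarith), if_neg h.not_gt]

theorem IsCasimirParameter.norm_coeff_le_of_neg [CompleteSpace H] (hlam : IsCasimirParameter T lam)
    (hT : IsStronglyContinuous T) (hφ : IsKTypeBasis T φ) (h : lam < 0) (ht : 1 ≤ t) :
    ‖coeff T φ n m t‖ ≤ (Kbar lam * ((m : ℝ) ^ 2 + (n : ℝ) ^ 2) + Ktilde lam) * b lam t := by
  have hφm := hφ.isCkVector hT 2 m
  have hsol := hlam.isRadialSolution_inner_diag (hφ.mem m) hφm (hφ.norm_le_one m) (hφ.mem n)
    (hφ.isCkVector hT 1 n) (hφ.norm_le_one n)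
  have hderiv := (norm_inner_apply_le (T := T) (hφ.norm_le_one n) (diag 1) _).trans
    (hlam.norm_lieDeriv_diag_le (hφ.mem m) hφm (hφ.norm_le_one m))
  have hconst : Real.exp 1 * (3 + (m : ℝ) ^ 2 / 2) +
      C1 * C2 * ((n : ℝ) ^ 2 + (m : ℝ) ^ 2 + 1) * Real.exp (-1) ≤
      Kbar lam * ((m : ℝ) ^ 2 + (n : ℝ) ^ 2) + Ktilde lam := calc
    _ ≤ (C1 * C2 * Real.exp (-1) + Real.exp 1 / 2) * ((m : ℝ) ^ 2 + (n : ℝ) ^ 2) +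
        (C1 * C2 * Real.exp (-1) + 3 * Real.exp 1) := by
      linarith [mul_nonneg (Real.exp_pos 1).le (sq_nonneg (n : ℝ))]
    _ ≤ _ := by
      gcongr
      exacts [C1_mul_C2_add_le_Kbar h, C1_mul_C2_add_le_Ktilde h]
  rw [b_of_neg h]
  exact (hsol.norm_le_of_norm_deriv_le hderiv ht).trans (by gcongr)

theorem IsCasimirParameter.norm_coeff_le_of_nonneg [CompleteSpace H]
    (hlam : IsCasimirParameter T lam) (hT : IsStronglyContinuous T) (hirr : IsIrreducible T)
    (hnontriv : ∃ g : SL(2, ℝ), T g ≠ 1) (hφ : IsKTypeBasis T φ) (h : 0 ≤ lam) (ht : 1 ≤ t) :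
    ‖coeff T φ n m t‖ ≤ (Kbar lam * ((m : ℝ) ^ 2 + (n : ℝ) ^ 2) + Ktilde lam) * b lam t := by
  have hC1 := C1_pos
  have hC2 := C2_pos
  have := sub_nonneg.2 ht
  rw [Kbar_of_nonneg h, Ktilde_of_nonneg h, b_of_nonneg h, coeff]
  rcases eq_or_ne (φ m) 0 with h₀ | h₀
  · rw [h₀, map_zero, inner_zero_right, norm_zero]
    positivity
  have hφm := hφ.isCkVector hT 2 m
  have hsol := hlam.isRadialSolution_inner_diag (hφ.mem m) hφm (hφ.norm_le_one m) (hφ.mem n)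
    (hφ.isCkVector hT 1 n) (hφ.norm_le_one n)
  have hconst : Real.exp 2 + C1 * C2 * ((n : ℝ) ^ 2 + (m : ℝ) ^ 2) / 2 * (t - 1) ≤
      ((C1 + C2) / 2 * ((m : ℝ) ^ 2 + (n : ℝ) ^ 2) + Real.exp 2) * t := calc
    _ ≤ Real.exp 2 * t + (C1 + C2) * ((n : ℝ) ^ 2 + (m : ℝ) ^ 2) / 2 * t := by
      gcongr
      exacts [le_mul_of_one_le_right (Real.exp_pos 2).le ht, C1_mul_C2_le, by linarith]
    _ = _ := by ring
  rw [← mul_assoc]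
  refine (hsol.norm_le_of_tendsto h
    (hlam.one_le_kType_sq hT hirr hnontriv h (hφ.mem m) hφm h₀)
    (tendsto_inner_diag_atTop hT hirr hnontriv _ _)
    (tendsto_inner_diag_atTop hT hirr hnontriv _ _) ht).trans ?_
  gcongr

end Constants

end Ratner

theorem lemma4p1 {H : Type*} [NormedAddCommGroup H] [InnerProductSpace ℂ H] [CompleteSpace H]
    [TopologicalSpace.SeparableSpace H]
    (T : SL(2, ℝ) →* (H ≃ₗᵢ[ℂ] H)) (hcont : Ratner.IsStronglyContinuous T)
    (hirr : Ratner.IsIrreducible T) (hnontriv : ∃ g : SL(2, ℝ), T g ≠ 1)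
    (φ : ℤ → H) (hφ : Ratner.IsKTypeBasis T φ) :
    (∃! lam : ℝ, Ratner.IsCasimirParameter T lam) ∧
    ∀ lam : ℝ, Ratner.IsCasimirParameter T lam →
      ∀ (n m : ℤ) (t : ℝ), 1 ≤ t →
        ‖Ratner.coeff T φ n m t‖ ≤
          (Ratner.Kbar lam * ((m : ℝ) ^ 2 + (n : ℝ) ^ 2) + Ratner.Ktilde lam) *
            Ratner.b lam t := by
  refine ⟨hφ.existsUnique_isCasimirParameter hcont hirr, fun lam hlam n m t ht => ?_⟩
  rcases lt_or_ge lam 0 with h | h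
  · exact hlam.norm_coeff_le_of_neg hcont hφ h ht
  · exact hlam.norm_coeff_le_of_nonneg hcont hirr hnontriv hφ h ht
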